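/- **Theorem (Lines from permutations).** Let $n\ge 3$, let $G\le S_n$ be a doubly transitive permutation group, let $i_0\in\{1,\dots,n\}$, and let $G_0\le G$ be the stabilizer of $i_0$. Let $\pi\colon G^*\to G$ be any Schur covering, that is, an epimorphism whose kernel is contained in both the center and the commutator subgroup of $G^*$ and is isomorphic to the Schur multiplier of $G$ (the group of 2-cocycles $G\times G\to\mathbb C^\times$ modulo 2-coboundaries). Put $G_0^*=\pi^{-1}(G_0)$. Let $\mathscr L=(\ell_1,\dots,\ell_n)$ be a sequence of $n>d$ one-dimensional subspaces (lines) spanning $\mathbb C^d$ such that $G$ is a group of automorphisms of $\mathscr L$: for every $\sigma\in G$ there is a unitary $Q\in\mathrm U(d)$ with $Q\ell_i=\ell_{\sigma(i)}$ for all $i$. Then there is a linear character $\alpha\colon G_0^*\to\mathbb T$ with the following properties. Put $r=2\,|\operatorname{im}\alpha|$, let $C_r\le\mathbb C^\times$ be the group of $r$th roots of unity, define $\widetilde\alpha\colon G_0^*\times C_r\to C_r$ by $\widetilde\alpha(x,z)=\alpha(x)z$, and put $\widetilde G^*=G^*\times C_r$, $H=\ker\widetilde\alpha$ and $K=N_{\widetilde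 G^*}(H)$. (The pair $(\widetilde G^*,H)$ is the radicalization of $(G^*,G_0^*,\alpha)$.) (a) $(\widetilde G^*,H)$ is a Higman pair: $\widetilde G^*$ is finite, $H$ is a proper subgroup, $\widetilde G^*$ acts doubly transitively on $\widetilde G^*/K$, $K/H$ is abelian, and there is $b\in\widetilde G^*\setminus K$ such that $HbH=Hb^{-1}H$, $aba^{-1}\in HbH$ for all $a\in K$, and, for $a\in K$, $ab\in HbH$ only if $a\in H$. (b) $[\widetilde G^*:K]=n$ and $[K:H]=r$. Let $X=\widetilde G^*/H$. The Schurian scheme of $(\widetilde G^*,H)$, which consists of the indicator matrices in $\mathbb C^{X\times X}$ of the orbits of $\widetilde G^*$ on $X\times X$, is commutative. Among the orthogonal projections in its adjacency algebra (the span of these matrices) there is a primitive idempotent (a minimal nonzero one) that is the Gram matrix of $r$ distinct representatives (spanning vectors) of each of the $n$ lines of $\mathscr L$, all $rn$ of the same norm. If moreover $d\ge 2$ (equivalently, the $n$ lines are not all equal), then this Gram matrix carries the scheme: it is a linear combination of the indicator matrices with pairwise distinct coefficients. -/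

import Mathlib

open scoped Matrix

noncomputable section

/-! ## Schur multiplier and Schur coverings -/

/-- The group of 2-cocycles `G × G → ℂˣ` (trivial action), under pointwise multiplication. -/
def twoCocycles (G : Type*) [Group G] : Subgroup (G → G → ℂˣ) where
  carrier := {f | ∀ x y z, f x y * f (x * y) z = f y z * f x (y * z)}
  one_mem' := by intro x y z; simp
  mul_mem' := by
    intro f g hf hg x y z
    have h := congrArg₂ (· * ·) (hf x y z) (hg x y z)
    simpa [mul_mul_mul_comm] using h
  inv_mem' := by
    intro f hf x y z
    have h := congrArg (·⁻¹) (hf x y z)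
    simpa [mul_comm] using h

/-- The group of 2-coboundaries `(x, y) ↦ t x * t y * (t (x * y))⁻¹`. -/
def twoCoboundaries (G : Type*) [Group G] : Subgroup (G → G → ℂˣ) where
  carrier := {f | ∃ t : G → ℂˣ, ∀ x y, f x y = t x * t y * (t (x * y))⁻¹}
  one_mem' := ⟨1, by simp⟩
  mul_mem' := by
    rintro f g ⟨s, hs⟩ ⟨t, ht⟩
    refine ⟨s * t, fun x y => ?_⟩
    simp only [Pi.mul_apply, hs, ht, mul_inv]
    ac_rfl
  inv_mem' := by
    rintro f ⟨t, ht⟩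
    refine ⟨t⁻¹, fun x y => ?_⟩
    simp only [Pi.inv_apply, ht, mul_inv, inv_inv]

/-- The Schur multiplier `M(G)`: 2-cocycles modulo 2-coboundaries.  (Every 2-coboundary is a
2-cocycle, see `twoCoboundaries_le`.) -/
abbrev SchurMultiplier (G : Type*) [Group G] : Type _ :=
  twoCocycles G ⧸ (twoCoboundaries G).subgroupOf (twoCocycles G)

theorem twoCoboundaries_le (G : Type*) [Group G] : twoCoboundaries G ≤ twoCocycles G := by
  rintro f ⟨t, ht⟩ x y z
  simp only [ht, mul_assoc x y z]
  rw [Units.ext_iff]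
  push_cast
  field_simp

/-- `π : Gs → G` is a Schur covering: an epimorphism whose kernel is contained in the center and
in the commutator subgroup of `Gs`, and is isomorphic to the Schur multiplier of `G`. -/
structure IsSchurCovering {Gs G : Type*} [Group Gs] [Group G] (π : Gs →* G) : Prop where
  surjective : Function.Surjective π
  ker_le_center : π.ker ≤ Subgroup.center Gs
  ker_le_commutator : π.ker ≤ commutator Gs
  ker_equiv : Nonempty (π.ker ≃* SchurMultiplier G)

/-! ## Radicalization -/

section Radicalization

variable {G : Type*} [Group G] {G₀ : Subgroup G}

/-- `r = 2 r'`, where `r'` is the order of the image of the linear character `α`. -/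
def radOrder (α : G₀ →* Circle) : ℕ := 2 * Nat.card α.range

/-- `C_r`, the group of `r`th roots of unity in `ℂ`, for `r = radOrder α`. -/
abbrev radRoots (α : G₀ →* Circle) : Subgroup ℂˣ := rootsOfUnity (radOrder α) ℂ

theorem toUnits_mem_radRoots (α : G₀ →* Circle) (x : G₀) :
    Circle.toUnits (α x) ∈ radRoots α := by
  have h : (⟨α x, x, rfl⟩ : α.range) ^ Nat.card α.range = 1 := pow_card_eq_one'
  have h' : α x ^ Nat.card α.range = 1 := congrArg Subtype.val h
  rw [mem_rootsOfUnity, radOrder, mul_comm, pow_mul, ← map_pow, h', map_one, one_pow]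

/-- `α̃ : G₀ × C_r → C_r`, `α̃ (x, z) = α x * z`. -/
def radCharacter (α : G₀ →* Circle) : G₀ × radRoots α →* radRoots α :=
  MonoidHom.coprod
    ((Circle.toUnits.comp α).codRestrict (radRoots α) (toUnits_mem_radRoots α))
    (MonoidHom.id (radRoots α))

/-- The subgroup `H = ker α̃` of `G × C_r`; the radicalization of `(G, G₀, α)` is the pair
`(G × C_r, H)`. -/
def radSubgroup (α : G₀ →* Circle) : Subgroup (G × radRoots α) :=
  (radCharacter α).ker.map (G₀.subtype.prodMap (MonoidHom.id (radRoots α)))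

end Radicalization

/-! ## Higman pairs -/

/-- `b` is a key for `(G, H)`, where `K = N_G(H)`. -/
structure IsHigmanKey {G : Type*} [Group G] (H : Subgroup G) (b : G) : Prop where
  not_mem : b ∉ Subgroup.normalizer (H : Set G)
  doubleCoset_inv : DoubleCoset.doubleCoset b (H : Set G) H = DoubleCoset.doubleCoset b⁻¹ H H
  conj_mem : ∀ a ∈ Subgroup.normalizer (H : Set G),
    a * b * a⁻¹ ∈ DoubleCoset.doubleCoset b (H : Set G) H
  mem_of_mul_mem : ∀ a ∈ Subgroup.normalizer (H : Set G),
    a * b ∈ DoubleCoset.doubleCoset b (H : Set G) H → a ∈ H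

/-- `(G, H)` is a Higman pair. -/
structure IsHigmanPair {G : Type*} [Group G] (H : Subgroup G) : Prop where
  finite : Finite G
  proper : H ≠ ⊤
  doublyTransitive :
    MulAction.IsMultiplyPretransitive G (G ⧸ Subgroup.normalizer (H : Set G)) 2
  abelian : ∀ x y : Subgroup.normalizer (H : Set G) ⧸
    H.subgroupOf (Subgroup.normalizer (H : Set G)), x * y = y * x
  exists_key : ∃ b : G, IsHigmanKey H b

/-! ## Schurian schemes -/

section Schemes

variable {ι X : Type*}

/-- The adjacency algebra (as a space of matrices) of a family of adjacency matrices. -/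
def adjacencyAlgebra (A : ι → Matrix X X ℂ) : Submodule ℂ (Matrix X X ℂ) :=
  Submodule.span ℂ (Set.range A)

/-- The adjacency algebra is commutative. -/
def IsCommutativeScheme [Fintype X] (A : ι → Matrix X X ℂ) : Prop :=
  ∀ M ∈ adjacencyAlgebra A, ∀ N ∈ adjacencyAlgebra A, M * N = N * M

/-- `P` is an orthogonal projection in the adjacency algebra. -/
def IsSchemeProjection [Fintype X] (A : ι → Matrix X X ℂ) (P : Matrix X X ℂ) : Prop :=
  P ∈ adjacencyAlgebra A ∧ Pᴴ = P ∧ P * P = P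

/-- `E` is a primitive idempotent of a commutative scheme: a nonzero orthogonal projection in the
adjacency algebra that has no orthogonal projection of the adjacency algebra strictly between
`0` and itself. -/
def IsPrimitiveIdempotent [Fintype X] (A : ι → Matrix X X ℂ) (E : Matrix X X ℂ) : Prop :=
  IsCommutativeScheme A ∧ IsSchemeProjection A E ∧ E ≠ 0 ∧
    ∀ P, IsSchemeProjection A P → E * P = P → P = 0 ∨ P = E

/-- `M` carries the scheme: `M` is a linear combination of the adjacency matrices with pairwise
distinct coefficients. -/
def CarriesScheme [Fintype ι] (A : ι → Matrix X X ℂ) (M : Matrix X X ℂ) : Prop :=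
  ∃ c : ι → ℂ, Function.Injective c ∧ M = ∑ i, c i • A i

end Schemes

/-- The orbits of `G` on `X × X` under the diagonal action, for `X = G ⧸ H`. -/
abbrev Orbital {G : Type*} [Group G] (H : Subgroup G) : Type _ :=
  MulAction.orbitRel.Quotient G ((G ⧸ H) × (G ⧸ H))

instance {G : Type*} [Group G] (H : Subgroup G) [Fintype (G ⧸ H)] : Fintype (Orbital H) :=
  Fintype.ofFinite _

open Classical in
/-- The Schurian scheme of `(G, H)`: the indicator matrices of the orbits of `G` on `X × X`,
for `X = G ⧸ H`. -/
def schurianScheme {G : Type*} [Group G] (H : Subgroup G) (R : Orbital H) :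
    Matrix (G ⧸ H) (G ⧸ H) ℂ :=
  fun x y => if (x, y) ∈ R.orbit then 1 else 0

/-! ## Lines in `ℂ^d` -/

/-- `σ` is an automorphism of the sequence of lines `ℓ`: it is realized by a unitary operator. -/
def IsLineAutomorphism {n d : ℕ} (ℓ : Fin n → Submodule ℂ (EuclideanSpace ℂ (Fin d)))
    (σ : Equiv.Perm (Fin n)) : Prop :=
  ∃ Q : EuclideanSpace ℂ (Fin d) ≃ₗᵢ[ℂ] EuclideanSpace ℂ (Fin d),
    ∀ i, (ℓ i).map (Q.toLinearEquiv : EuclideanSpace ℂ (Fin d) →ₗ[ℂ] EuclideanSpace ℂ (Fin d))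
      = ℓ (σ i)

/-- `M` is, up to the indexing of its rows and columns, the Gram matrix of `r` (distinct)
representatives `v i 0, …, v i (r - 1)` of each line `ℓ i`, all of them of the same norm. -/
def IsGramOfRepresentatives {n d : ℕ} (ℓ : Fin n → Submodule ℂ (EuclideanSpace ℂ (Fin d)))
    (r : ℕ) {X : Type*} (M : Matrix X X ℂ) : Prop :=
  ∃ (e : X ≃ Fin n × Fin r) (v : Fin n → Fin r → EuclideanSpace ℂ (Fin d)),
    (∀ i k, Submodule.span ℂ {v i k} = ℓ i) ∧
    (∀ i, Function.Injective (v i)) ∧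
    (∀ i k j l, ‖v i k‖ = ‖v j l‖) ∧
    ∀ x y, M x y = inner ℂ (v (e x).1 (e x).2) (v (e y).1 (e y).2)

end

/-! Choose a unit vector on each line. Distinct lines are never orthogonal: by double transitivity
all pairs would be, giving `n > d` independent vectors in `ℂ^d`. Since the lines span and no inner
product vanishes, the unitary realizing a permutation is unique up to a phase, so `G` acts
projectively. For a Schur covering, transgression `Hom(ker π, ℂˣ) → M(G)` is an injection between
finite sets of equal size. Hence every 2-cocycle of `G` becomes trivial on `Gs`, and the projective
action lifts to a unitary representation of `Gs` (`IsSchurCovering.exists_lift`). The preimage of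
the stabilizer of `i₀` acts on the line `ℓ i₀` through a character; this is `α`.

After adjoining the scalars `C_r`, the subgroup `H` is the stabilizer of a unit vector `v` on that
line; `EquivariantLines` records this situation. The main tool is the coefficient `g ↦ ⟪v, g v⟫`. It
is constant on `H`-double cosets, never zero, and multiplied by `z` when `g` is multiplied by the
scalar `z`. By double transitivity, any two elements moving the base line differ by `H` on both
sides and a scalar, and the coefficient detects the scalar. The key `b` lifts an element swapping
two indices and is corrected by a scalar so that `b² ∈ H`; the factor 2 in `r` supplies the square
root needed.

All relations of the scheme are therefore central scalars or `b` times a scalar, so the scheme is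
commutative. The representation is irreducible, again because `d < n` (`exists_smul_of_commute`).
Hence compressing an invariant matrix by the Gram matrix of the orbit of `v` gives a multiple of
that Gram matrix, which after rescaling is a primitive idempotent. -/

/-! ### Finiteness of the Schur multiplier -/

theorem exists_units_pow_eq {N : ℕ} (hN : N ≠ 0) (t : ℂˣ) : ∃ s : ℂˣ, s ^ N = t := by
  obtain ⟨z, hz⟩ := IsAlgClosed.exists_pow_nat_eq (t : ℂ) (Nat.pos_of_ne_zero hN)
  have hz0 : z ≠ 0 := by
    rintro rfl
    rw [zero_pow hN] at hz
    exact t.ne_zero hz.symm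
  exact ⟨Units.mk0 z hz0, Units.ext (by simpa using hz)⟩

/-- The `|G|`-th power of a 2-cocycle is a 2-coboundary. -/
theorem twoCocycles_pow_card {G : Type*} [Group G] [Fintype G] {f : G → G → ℂˣ}
    (hf : f ∈ twoCocycles G) (x y : G) :
    f x y ^ Fintype.card G =
      (∏ z, f x z) * (∏ z, f y z) * (∏ z, f (x * y) z)⁻¹ := by
  -- Multiply the cocycle identity over all `z`; the substitution `z ↦ y * z` turns the last factor
  -- into `∏ z, f x z`.
  have h : ∏ z, (f x y * f (x * y) z) = ∏ z, (f y z * f x (y * z)) :=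
    Finset.prod_congr rfl fun z _ => hf x y z
  rw [Finset.prod_mul_distrib, Finset.prod_mul_distrib, Finset.prod_const, Finset.card_univ,
    Fintype.prod_equiv (Equiv.mulLeft y) (fun z => f x (y * z)) (fun z => f x z)
      (fun z => rfl)] at h
  rw [eq_mul_inv_iff_mul_eq, h, mul_comm]

/-- Since the `|G|`-th power of a cocycle is a coboundary, dividing by the coboundary of a `|G|`-th
root leaves values in the `|G|`-th roots of unity. There are finitely many such cocycles, and they
represent every class. -/
theorem finite_schurMultiplier (G : Type*) [Group G] [Finite G] : Finite (SchurMultiplier G) := by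
  have := Fintype.ofFinite G
  set N := Fintype.card G with hN
  have hN0 : N ≠ 0 := Fintype.card_ne_zero
  have : NeZero N := ⟨hN0⟩
  let T := {f : twoCocycles G // ∀ x y, f.1 x y ^ N = 1}
  have : Finite T := by
    refine Finite.of_injective (β := G → G → rootsOfUnity N ℂ)
      (fun f x y => ⟨f.1.1 x y, by rw [mem_rootsOfUnity]; exact f.2 x y⟩) ?_
    intro f g hfg
    apply Subtype.ext
    apply Subtype.ext
    funext x y
    exact congrArg Subtype.val (congrFun (congrFun hfg x) y)
  refine Finite.of_surjective (α := T) (fun f => (f.1 : SchurMultiplier G)) ?_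
  intro c
  obtain ⟨f, rfl⟩ := QuotientGroup.mk_surjective c
  choose s hs using fun x => exists_units_pow_eq hN0 (∏ z, f.1 x z)
  have hcob : (fun x y => (s x)⁻¹ * (s y)⁻¹ * s (x * y)) ∈ twoCoboundaries G :=
    ⟨fun x => (s x)⁻¹, fun x y => by simp⟩
  let g : twoCocycles G := ⟨_, twoCoboundaries_le G hcob⟩
  refine ⟨⟨f * g, ?_⟩, ?_⟩
  · intro x y
    have := twoCocycles_pow_card f.2 x y
    simp only [Subgroup.coe_mul, Pi.mul_apply, mul_pow, g, inv_pow, hs]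
    simp [hN, this, mul_assoc, mul_left_comm]
  · refine (QuotientGroup.eq.mpr ?_).symm
    rw [Subgroup.mem_subgroupOf]
    simpa [g] using! hcob

/-! ### Transgression and inflation along a Schur covering -/

section Transgression

variable {Gs G : Type*} [Group Gs] [Group G]

theorem IsSchurCovering.finite_ker [Finite G] {π : Gs →* G} (hπ : IsSchurCovering π) :
    Finite π.ker := by
  obtain ⟨e⟩ := hπ.ker_equiv
  have := finite_schurMultiplier G
  exact Finite.of_equiv _ e.symm.toEquiv

theorem IsSchurCovering.finite [Finite G] {π : Gs →* G} (hπ : IsSchurCovering π) :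
    Finite Gs := by
  have := hπ.finite_ker
  have : Finite (Gs ⧸ π.ker) :=
    Finite.of_equiv _ (QuotientGroup.quotientKerEquivOfSurjective π hπ.surjective).symm.toEquiv
  exact Finite.of_equiv _ (Subgroup.groupEquivQuotientProdSubgroup (s := π.ker)).symm

/-- The kernel component of `x` with respect to a section `s` of `π`. -/
def kerPart (π : Gs →* G) (s : G → Gs) (hs : ∀ g, π (s g) = g) (x : Gs) : π.ker :=
  ⟨x * (s (π x))⁻¹, by simp [MonoidHom.mem_ker, hs]⟩

theorem kerPart_mul (π : Gs →* G) (hc : π.ker ≤ Subgroup.center Gs) (s : G → Gs)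
    (hs : ∀ g, π (s g) = g) (x y : Gs) :
    kerPart π s hs (x * y) =
      kerPart π s hs x * kerPart π s hs y * kerPart π s hs (s (π x) * s (π y)) := by
  have hx := Subgroup.mem_center_iff.mp (hc (kerPart π s hs x).2)
  have hy := Subgroup.mem_center_iff.mp (hc (kerPart π s hs y).2)
  apply Subtype.ext
  have e : ∀ z, z = (kerPart π s hs z : Gs) * s (π z) := fun z => by simp [kerPart]
  have h2 : (kerPart π s hs (s (π x) * s (π y)) : Gs) =
      s (π x) * s (π y) * (s (π (x * y)))⁻¹ := by simp [kerPart, hs]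
  rw [Subgroup.coe_mul, Subgroup.coe_mul, h2]
  calc (kerPart π s hs (x * y) : Gs) = x * y * (s (π (x * y)))⁻¹ := rfl
    _ = (kerPart π s hs x : Gs) * s (π x) * ((kerPart π s hs y : Gs) * s (π y)) *
        (s (π (x * y)))⁻¹ := by rw [← e x, ← e y]
    _ = (kerPart π s hs x : Gs) * (s (π x) * (kerPart π s hs y : Gs)) * s (π y) *
        (s (π (x * y)))⁻¹ := by simp only [mul_assoc]
    _ = _ := by rw [hy (s (π x))]; simp only [mul_assoc]

theorem kerPart_section (π : Gs →* G) (s : G → Gs) (hs : ∀ g, π (s g) = g) (g : G) :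
    kerPart π s hs (s g) = 1 :=
  Subtype.ext (by simp [kerPart, hs])

/-- The 2-cocycle on `G` that a character of the kernel of a central extension determines. -/
def transgression (π : Gs →* G) (hc : π.ker ≤ Subgroup.center Gs) (s : G → Gs)
    (hs : ∀ g, π (s g) = g) (χ : π.ker →* ℂˣ) : twoCocycles G :=
  ⟨fun x y => χ (kerPart π s hs (s x * s y)), by
    intro x y z
    have h1 := kerPart_mul π hc s hs (s x * s y) (s z)
    have h2 := kerPart_mul π hc s hs (s x) (s y * s z)
    simp only [map_mul, hs, kerPart_section, mul_one, one_mul] at h1 h2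
    rw [← mul_assoc, h1] at h2
    have h3 := congrArg χ h2
    simpa only [map_mul] using h3⟩

/-- If two characters of the kernel have cohomologous images, the cochain `t` extends their quotient
`ψ` to a character `Λ` of `Gs`, up to a constant that turns out to be trivial. A character to an
abelian group kills the commutator subgroup, hence the kernel, so `ψ = 1`. -/
theorem transgression_injective {π : Gs →* G} (hc : π.ker ≤ Subgroup.center Gs)
    (hcomm : π.ker ≤ commutator Gs) {s : G → Gs} (hs : ∀ g, π (s g) = g) :
    Function.Injective fun χ : π.ker →* ℂˣ =>
      (transgression π hc s hs χ : SchurMultiplier G) := by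
  intro χ₁ χ₂ h
  obtain ⟨t, ht⟩ := Subgroup.mem_subgroupOf.mp (QuotientGroup.eq.mp h)
  let ψ : π.ker →* ℂˣ := χ₁⁻¹ * χ₂
  have ht' : ∀ x y, ψ (kerPart π s hs (s x * s y)) = t x * t y * (t (x * y))⁻¹ := ht
  let Λ : Gs →* ℂˣ := MonoidHom.mk' (fun x => ψ (kerPart π s hs x) * t (π x)) (by
    intro x y
    rw [kerPart_mul π hc, map_mul, map_mul, ht', map_mul]
    rw [Units.ext_iff]
    push_cast
    field_simp)
  have hΛ : commutator Gs ≤ Λ.ker := Abelianization.commutator_subset_ker Λ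
  have h1 : ψ (kerPart π s hs 1) * t 1 = 1 := by
    have := map_one Λ
    simpa [Λ] using this
  have key : ∀ a : π.ker, ψ a = 1 := by
    intro a
    have ha : π (a : Gs) = 1 := a.2
    have h2 : ψ (kerPart π s hs (a : Gs)) * t 1 = 1 := by
      have := MonoidHom.mem_ker.mp (hΛ (hcomm a.2))
      simpa [Λ, ha] using this
    have h3 : kerPart π s hs (a : Gs) = a * kerPart π s hs 1 :=
      Subtype.ext (by simp [kerPart, ha])
    rw [h3, map_mul, mul_assoc, h1, mul_one] at h2
    exact h2
  ext a
  have := key a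
  rw [MonoidHom.mul_apply, MonoidHom.inv_apply, inv_mul_eq_one] at this
  rw [this]

/-- Inflation along a Schur covering of a finite group trivializes every 2-cocycle. -/
theorem IsSchurCovering.exists_inflation [Finite G] {π : Gs →* G} (hπ : IsSchurCovering π)
    {f : G → G → ℂˣ} (hf : f ∈ twoCocycles G) :
    ∃ T : Gs → ℂˣ, ∀ x y, f (π x) (π y) * T (x * y) = T x * T y := by
  have := finite_schurMultiplier G
  have hker := hπ.finite_ker
  let _ : CommGroup π.ker :=
    { mul_comm := fun a b => Subtype.ext (Subgroup.mem_center_iff.mp (hπ.ker_le_center b.2) a) }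
  have : NeZero (Monoid.exponent π.ker) := ⟨Monoid.exponent_ne_zero_of_finite⟩
  obtain ⟨e₁⟩ := CommGroup.monoidHom_mulEquiv_of_hasEnoughRootsOfUnity π.ker ℂ
  obtain ⟨e₂⟩ := hπ.ker_equiv
  obtain ⟨s, hs⟩ := hπ.surjective.hasRightInverse
  have hinj := transgression_injective hπ.ker_le_center hπ.ker_le_commutator hs
  have : Finite (π.ker →* ℂˣ) := Finite.of_equiv _ e₁.symm.toEquiv
  -- The finite abelian group `ker π` has as many characters as elements, and it is isomorphic to
  -- `M(G)`; injectivity thus gives surjectivity.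
  have hsurj := (hinj.bijective_of_nat_card_le
    (Nat.card_congr (e₁.toEquiv.trans e₂.toEquiv)).ge).2
  obtain ⟨χ, hχ⟩ := hsurj ((⟨f, hf⟩ : twoCocycles G) : SchurMultiplier G)
  obtain ⟨t, ht⟩ := Subgroup.mem_subgroupOf.mp (QuotientGroup.eq.mp hχ)
  have ht' : ∀ x y, (χ (kerPart π s hs (s x * s y)))⁻¹ * f x y = t x * t y * (t (x * y))⁻¹ := ht
  -- The transgressed part of `f` becomes, on `Gs`, the coboundary of `x ↦ (χ (kerPart π s hs x))⁻¹`
  -- by `kerPart_mul`; the remaining part is the coboundary of `t`, pulled back along `π`.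
  refine ⟨fun x => (χ (kerPart π s hs x))⁻¹ * t (π x), fun x y => ?_⟩
  have h := ht' (π x) (π y)
  rw [inv_mul_eq_iff_eq_mul] at h
  beta_reduce
  rw [kerPart_mul π hπ.ker_le_center, map_mul, map_mul, h, map_mul, Units.ext_iff]
  push_cast
  field_simp

end Transgression

/-! ### Lifting projective unitary representations -/

/-- The phase `z / ‖z‖` of a nonzero complex number. -/
noncomputable def unitsPhase : ℂˣ →* Circle where
  toFun z := ⟨(z : ℂ) / ‖(z : ℂ)‖, mem_sphere_zero_iff_norm.mpr (by simp)⟩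
  map_one' := Circle.ext (by simp)
  map_mul' z w := Circle.ext (by
    change ((z * w : ℂˣ) : ℂ) / ‖((z * w : ℂˣ) : ℂ)‖ = (z : ℂ) / ‖(z : ℂ)‖ * ((w : ℂ) / ‖(w : ℂ)‖)
    simp [mul_div_mul_comm])

theorem unitsPhase_toUnits (z : Circle) : unitsPhase (Circle.toUnits z) = z :=
  Circle.ext (by
    change (Circle.coeHom z : ℂ) / ‖(Circle.coeHom z : ℂ)‖ = Circle.coeHom z
    have h : ‖(Circle.coeHom z : ℂ)‖ = 1 := Circle.norm_coe z
    rw [h, Complex.ofReal_one, div_one])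

/-- A projective unitary representation of a finite group lifts to a representation of every
Schur covering. -/
theorem IsSchurCovering.exists_lift {Gs G V : Type*} [Group Gs] [Group G] [Finite G]
    [NormedAddCommGroup V] [InnerProductSpace ℂ V] [Nontrivial V]
    {π : Gs →* G} (hπ : IsSchurCovering π) (q : G → V ≃ₗᵢ[ℂ] V)
    (f : G → G → Circle) (hf : ∀ x y v, q x (q y v) = f x y • q (x * y) v) :
    ∃ (ρ : Gs →* Module.End ℂ V) (c : Gs → Circle), ∀ x v, ρ x v = c x • q (π x) v := by
  obtain ⟨v₀, hv₀⟩ := exists_ne (0 : V)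
  have hinj : ∀ (x : G) (a b : Circle), a • q x v₀ = b • q x v₀ → a = b := by
    intro x a b h
    have hne : q x v₀ ≠ 0 := by simpa using hv₀
    exact Circle.ext (smul_left_injective ℂ hne h)
  have hsmul : ∀ (x : G) (a : Circle) (v : V), q x (a • v) = a • q x v := fun x a v =>
    (q x).map_smul (a : ℂ) v
  have hcoc : ∀ x y z, f x y * f (x * y) z = f y z * f x (y * z) := by
    intro x y z
    apply hinj (x * y * z)
    rw [mul_smul, mul_smul, ← hf, ← hf, mul_assoc x y z, ← hf, ← hsmul, ← hf]
  obtain ⟨T, hT⟩ := hπ.exists_inflation (f := fun x y => Circle.toUnits (f x y))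
    (fun x y z => by simp only [← map_mul, hcoc])
  -- The trivializing cochain takes values in `ℂˣ`; passing to phases keeps the lift unitary and
  -- does not change `f`, which is already unimodular.
  have hT' : ∀ x y, f (π x) (π y) * unitsPhase (T (x * y)) =
      unitsPhase (T x) * unitsPhase (T y) := by
    intro x y
    rw [← map_mul, ← hT, map_mul, unitsPhase_toUnits]
  let c : Gs → Circle := fun x => (unitsPhase (T x))⁻¹
  have hc : ∀ x y, c (x * y) = c x * c y * f (π x) (π y) := by
    intro x y
    simp only [c]
    rw [← mul_inv, ← hT', mul_inv]
    simp [mul_comm]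
  have hmul : ∀ x y v, c (x * y) • q (π (x * y)) v = c x • q (π x) (c y • q (π y) v) := by
    intro x y v
    rw [hsmul, hf, hc, map_mul, smul_smul, smul_smul]
  let ρ₀ : Gs → Module.End ℂ V := fun x => (c x : ℂ) • (q (π x)).toLinearEquiv.toLinearMap
  have hρ₀ : ∀ x v, ρ₀ x v = c x • q (π x) v := fun x v => rfl
  refine ⟨⟨⟨ρ₀, ?_⟩, ?_⟩, c, hρ₀⟩
  · ext1 v
    -- The operator `ρ₀ 1` is idempotent and invertible, hence the identity: multiplicativity at
    -- `(1, 1)` is evaluated at the preimage of `v`.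
    have h := hmul 1 1 ((q (π 1)).symm ((c 1)⁻¹ • v))
    rw [mul_one, LinearIsometryEquiv.apply_symm_apply, smul_inv_smul] at h
    rw [hρ₀, ← h, Module.End.one_apply]
  · intro x y
    ext1 v
    rw [Module.End.mul_apply, hρ₀, hρ₀, hρ₀, hmul]

/-! ### Equivariant lines and the Higman pair -/

/-- A unitary representation `rep` of `Γ` that permutes `n` lines doubly transitively, with a
unit vector `vec` on the line of index `base` whose orbit meets that line in the multiples by
the `r`th roots of unity, and whose stabilizer is `H`. -/
structure EquivariantLines {Γ : Type*} [Group Γ] (H : Subgroup Γ) (V : Type*)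
    [NormedAddCommGroup V] [InnerProductSpace ℂ V] (n r : ℕ) where
  perm : Γ →* Equiv.Perm (Fin n)
  rep : Γ →* Module.End ℂ V
  base : Fin n
  vec : V
  scalar : rootsOfUnity r ℂ →* Γ
  inner_rep : ∀ g u w, inner ℂ (rep g u) (rep g w) = inner ℂ u w
  norm_vec : ‖vec‖ = 1
  mem_iff : ∀ g, g ∈ H ↔ perm g base = base ∧ rep g vec = vec
  exists_perm : ∀ {a b c d}, a ≠ b → c ≠ d → ∃ g, perm g a = c ∧ perm g b = d
  rep_scalar : ∀ z u, rep (scalar z) u = ((z : ℂˣ) : ℂ) • u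
  scalar_comm : ∀ z g, scalar z * g = g * scalar z
  perm_scalar : ∀ z, perm (scalar z) = 1
  exists_phase : ∀ g, perm g base = base →
    ∃ z : rootsOfUnity r ℂ, rep g vec = ((z : ℂˣ) : ℂ) • vec
  inner_ne_zero : ∀ g, inner ℂ vec (rep g vec) ≠ 0
  span_orbit : Submodule.span ℂ (Set.range fun g => rep g vec) = ⊤
  three_le : 3 ≤ n
  finrank_lt : Module.finrank ℂ V < n
  exists_swap : ∃ b, perm b base ≠ base ∧ b * b ∈ H

namespace EquivariantLines

variable {Γ : Type*} [Group Γ] {H : Subgroup Γ} {V : Type*}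
    [NormedAddCommGroup V] [InnerProductSpace ℂ V] {n r : ℕ} (L : EquivariantLines H V n r)

theorem vec_ne_zero : L.vec ≠ 0 := by
  intro h
  simpa [h] using L.norm_vec

theorem rep_mul_apply (g g' : Γ) (u : V) : L.rep (g * g') u = L.rep g (L.rep g' u) := by
  rw [map_mul, Module.End.mul_apply]

theorem perm_mul_apply (g g' : Γ) (i : Fin n) : L.perm (g * g') i = L.perm g (L.perm g' i) := by
  rw [map_mul, Equiv.Perm.mul_apply]

theorem rep_inv_rep (g : Γ) (u : V) : L.rep g⁻¹ (L.rep g u) = u := by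
  rw [← rep_mul_apply, inv_mul_cancel, map_one, Module.End.one_apply]

theorem rep_rep_inv (g : Γ) (u : V) : L.rep g (L.rep g⁻¹ u) = u := by
  rw [← rep_mul_apply, mul_inv_cancel, map_one, Module.End.one_apply]

theorem inner_rep_left (g : Γ) (u w : V) :
    inner ℂ (L.rep g u) w = inner ℂ u (L.rep g⁻¹ w) := by
  rw [← L.inner_rep g u, rep_rep_inv]

theorem rep_vec_of_mem {h : Γ} (hh : h ∈ H) : L.rep h L.vec = L.vec := ((L.mem_iff h).mp hh).2

theorem perm_of_mem {h : Γ} (hh : h ∈ H) : L.perm h L.base = L.base := ((L.mem_iff h).mp hh).1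

theorem phase_eq_one {z : rootsOfUnity r ℂ} (h : ((z : ℂˣ) : ℂ) = 1) : z = 1 :=
  Subtype.ext (Units.ext h)

theorem scalar_mem_iff (z : rootsOfUnity r ℂ) : L.scalar z ∈ H ↔ z = 1 := by
  constructor
  · intro h
    have h1 := L.rep_vec_of_mem h
    rw [L.rep_scalar] at h1
    apply phase_eq_one
    exact smul_left_injective ℂ L.vec_ne_zero (by simpa using h1)
  · rintro rfl
    rw [map_one]
    exact one_mem H

/-- The phase by which `g` acts on the base vector is realized by a central scalar, and removing it
leaves an element of `H`. -/
theorem exists_factor {g : Γ} (hg : L.perm g L.base = L.base) :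
    ∃ h ∈ H, ∃ z, g = h * L.scalar z := by
  obtain ⟨z, hz⟩ := L.exists_phase g hg
  refine ⟨g * L.scalar z⁻¹, ?_, z, ?_⟩
  · rw [L.mem_iff, perm_mul_apply, rep_mul_apply, L.perm_scalar, L.rep_scalar, map_smul, hz,
      smul_smul]
    refine ⟨hg, ?_⟩
    simp
  · rw [map_inv, inv_mul_cancel_right]

/-- The matrix coefficient of the base vector. -/
noncomputable def coeff (g : Γ) : ℂ := inner ℂ L.vec (L.rep g L.vec)

theorem coeff_mul_scalar (g : Γ) (z : rootsOfUnity r ℂ) :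
    L.coeff (g * L.scalar z) = ((z : ℂˣ) : ℂ) * L.coeff g := by
  rw [coeff, coeff, rep_mul_apply, L.rep_scalar, map_smul, inner_smul_right]

theorem coeff_mul_mul {h₁ h₂ : Γ} (hh₁ : h₁ ∈ H) (hh₂ : h₂ ∈ H) (g : Γ) :
    L.coeff (h₁ * g * h₂) = L.coeff g := by
  rw [coeff, coeff, rep_mul_apply, rep_mul_apply, L.rep_vec_of_mem hh₂, ← inv_inv h₁,
    ← inner_rep_left, L.rep_vec_of_mem (inv_mem hh₁)]

theorem coeff_one : L.coeff 1 = 1 := by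
  rw [coeff, map_one, Module.End.one_apply, inner_self_eq_norm_sq_to_K, L.norm_vec]
  simp

theorem eq_one_of_coeff_mul {g : Γ} {z : rootsOfUnity r ℂ}
    (h : L.coeff (g * L.scalar z) = L.coeff g) : z = 1 := by
  rw [coeff_mul_scalar] at h
  exact phase_eq_one (mul_right_cancel₀ (b := L.coeff g) (L.inner_ne_zero g) (by rw [h, one_mul]))

/-- Double transitivity supplies `k` fixing the base line and carrying its image under `g` to its
image under `g'`. Both `k` and `(k * g)⁻¹ * g'` then fix the base line, so each factors through `H`
and a scalar. -/
theorem exists_doubleCoset {g g' : Γ} (hg : L.perm g L.base ≠ L.base)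
    (hg' : L.perm g' L.base ≠ L.base) :
    ∃ h₁ ∈ H, ∃ h₂ ∈ H, ∃ z, g' = h₁ * g * h₂ * L.scalar z := by
  obtain ⟨k, hk1, hk2⟩ := L.exists_perm hg.symm hg'.symm
  have hk3 : L.perm ((k * g)⁻¹ * g') L.base = L.base := by
    rw [perm_mul_apply, map_inv, Equiv.Perm.inv_eq_iff_eq, perm_mul_apply, hk2]
  obtain ⟨h₁, hh₁, z₁, hz₁⟩ := L.exists_factor hk1
  obtain ⟨h₂, hh₂, z₂, hz₂⟩ := L.exists_factor hk3
  refine ⟨h₁, hh₁, h₂, hh₂, z₁ * z₂, ?_⟩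
  calc g' = k * g * ((k * g)⁻¹ * g') := by group
    _ = h₁ * (L.scalar z₁ * (g * h₂)) * L.scalar z₂ := by rw [hz₂, hz₁]; simp only [mul_assoc]
    _ = _ := by rw [L.scalar_comm, map_mul]; simp only [mul_assoc]

theorem exists_doubleCoset_of_coeff_eq {g g' : Γ} (hg : L.perm g L.base ≠ L.base)
    (hg' : L.perm g' L.base ≠ L.base) (h : L.coeff g' = L.coeff g) :
    ∃ h₁ ∈ H, ∃ h₂ ∈ H, g' = h₁ * g * h₂ := by
  obtain ⟨h₁, hh₁, h₂, hh₂, z, rfl⟩ := L.exists_doubleCoset hg hg'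
  have hz : z = 1 := L.eq_one_of_coeff_mul (g := h₁ * g * h₂) (by rw [h, L.coeff_mul_mul hh₁ hh₂])
  exact ⟨h₁, hh₁, h₂, hh₂, by rw [hz, map_one, mul_one]⟩

theorem mem_normalizer_iff (g : Γ) :
    g ∈ Subgroup.normalizer (H : Set Γ) ↔ L.perm g L.base = L.base := by
  have key : ∀ k, L.perm k L.base = L.base → ∀ h ∈ H, k * h * k⁻¹ ∈ H := by
    intro k hk h hh
    obtain ⟨h', hh', z, rfl⟩ := L.exists_factor hk
    have : h' * L.scalar z * h * (h' * L.scalar z)⁻¹ = h' * h * h'⁻¹ := by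
      rw [mul_assoc h', L.scalar_comm]; group
    rw [this]
    exact mul_mem (mul_mem hh' hh) (inv_mem hh')
  rw [Subgroup.mem_normalizer_iff]
  constructor
  · intro hg
    by_contra hne
    -- This is where `3 ≤ n` enters. If `g` normalizes `H`, then `H` fixes the image of the base
    -- index under `g`, whereas double transitivity moves that image to a third index `m` by an
    -- element of `H`.
    obtain ⟨m, hm1, hm2⟩ : ∃ m : Fin n, m ≠ L.base ∧ m ≠ L.perm g L.base := by
      have : Finset.card {L.base, L.perm g L.base} < (Finset.univ : Finset (Fin n)).card := by
        rw [Finset.card_fin]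
        exact lt_of_le_of_lt Finset.card_le_two L.three_le
      obtain ⟨m, -, hm⟩ := Finset.exists_mem_notMem_of_card_lt_card this
      simp only [Finset.mem_insert, Finset.mem_singleton, not_or] at hm
      exact ⟨m, hm⟩
    obtain ⟨k, hk1, hk2⟩ := L.exists_perm (Ne.symm hne) hm1.symm
    obtain ⟨h, hh, z, rfl⟩ := L.exists_factor hk1
    have h1 : g * (g⁻¹ * h * g) * g⁻¹ ∈ H := by simpa [mul_assoc] using hh
    have h2 := L.perm_of_mem ((hg _).mpr h1)
    rw [perm_mul_apply, perm_mul_apply, map_inv, Equiv.Perm.inv_eq_iff_eq] at h2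
    rw [perm_mul_apply, L.perm_scalar, Equiv.Perm.one_apply, h2] at hk2
    exact hm2 hk2.symm
  · intro hg h
    refine ⟨key g hg h, fun hh => ?_⟩
    have hg' : L.perm g⁻¹ L.base = L.base := by
      rw [map_inv, Equiv.Perm.inv_eq_iff_eq, hg]
    have := key g⁻¹ hg' _ hh
    simpa [mul_assoc] using this

theorem coeff_mul_of_perm {k : Γ} {z : rootsOfUnity r ℂ} {h : Γ} (hh : h ∈ H)
    (hk : k = h * L.scalar z) (g : Γ) :
    L.coeff (k * g) = ((z : ℂˣ) : ℂ) * L.coeff g := by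
  rw [hk, mul_assoc, L.scalar_comm, ← mul_assoc, coeff_mul_scalar]
  congr 1
  simpa using L.coeff_mul_mul hh (one_mem H) g

theorem isHigmanKey {b : Γ} (hb : L.perm b L.base ≠ L.base) (hbb : b * b ∈ H) :
    IsHigmanKey H b where
  not_mem := fun h => hb ((L.mem_normalizer_iff b).mp h)
  doubleCoset_inv := by
    symm
    apply DoubleCoset.doubleCoset_eq_of_mem
    rw [DoubleCoset.mem_doubleCoset]
    exact ⟨1, one_mem H, (b * b)⁻¹, inv_mem hbb, by group⟩
  conj_mem := by
    intro a ha
    rw [L.mem_normalizer_iff] at ha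
    obtain ⟨h, hh, z, rfl⟩ := L.exists_factor ha
    rw [DoubleCoset.mem_doubleCoset]
    refine ⟨h, hh, h⁻¹, inv_mem hh, ?_⟩
    rw [mul_assoc h, L.scalar_comm]; group
  mem_of_mul_mem := by
    intro a ha hab
    rw [L.mem_normalizer_iff] at ha
    obtain ⟨h, hh, z, rfl⟩ := L.exists_factor ha
    rw [DoubleCoset.mem_doubleCoset] at hab
    obtain ⟨h₁, hh₁, h₂, hh₂, he⟩ := hab
    -- Comparing the nonzero coefficients of both sides forces the scalar part of `a` to be 1.
    have h1 := congrArg L.coeff he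
    rw [L.coeff_mul_mul hh₁ hh₂, L.coeff_mul_of_perm hh rfl, ← coeff_mul_scalar] at h1
    rw [L.eq_one_of_coeff_mul h1, map_one, mul_one]
    exact hh

theorem exists_ne_base : ∃ i : Fin n, i ≠ L.base := by
  have : Nontrivial (Fin n) := Fin.nontrivial_iff_two_le.mpr (by have := L.three_le; omega)
  exact exists_ne _

theorem exists_perm_base (i : Fin n) : ∃ g, L.perm g L.base = i := by
  obtain ⟨j, hj⟩ := L.exists_ne_base
  have : Nontrivial (Fin n) := ⟨_, _, hj⟩
  obtain ⟨m, hm⟩ := exists_ne i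
  obtain ⟨g, hg, -⟩ := L.exists_perm hj.symm hm.symm
  exact ⟨g, hg⟩

theorem isHigmanPair (L : EquivariantLines H V n r) [Finite Γ] : IsHigmanPair H where
  finite := inferInstance
  proper := by
    rintro rfl
    obtain ⟨b, hb, -⟩ := L.exists_swap
    exact hb (L.perm_of_mem (Subgroup.mem_top b))
  doublyTransitive := by
    rw [MulAction.is_two_pretransitive_iff]
    have hne : ∀ g g' : Γ, (g : Γ ⧸ Subgroup.normalizer (H : Set Γ)) = g' ↔
        L.perm g L.base = L.perm g' L.base := by
      intro g g'
      rw [QuotientGroup.eq, L.mem_normalizer_iff, perm_mul_apply, map_inv,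
        Equiv.Perm.inv_eq_iff_eq, eq_comm]
    intro a b c d
    induction a using QuotientGroup.induction_on
    induction b using QuotientGroup.induction_on
    induction c using QuotientGroup.induction_on
    induction d using QuotientGroup.induction_on
    intro hab hcd
    rw [Ne, hne] at hab hcd
    obtain ⟨g, h1, h2⟩ := L.exists_perm hab hcd
    refine ⟨g, ?_, ?_⟩ <;>
    · rw [MulAction.Quotient.smul_coe, hne, smul_eq_mul, perm_mul_apply]
      assumption
  abelian := by
    intro x y
    obtain ⟨⟨x, hx⟩, rfl⟩ := QuotientGroup.mk_surjective x
    obtain ⟨⟨y, hy⟩, rfl⟩ := QuotientGroup.mk_surjective y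
    rw [← QuotientGroup.mk_mul, ← QuotientGroup.mk_mul, QuotientGroup.eq,
      Subgroup.mem_subgroupOf]
    obtain ⟨h₁, hh₁, z₁, rfl⟩ := L.exists_factor ((L.mem_normalizer_iff x).mp hx)
    obtain ⟨h₂, hh₂, z₂, rfl⟩ := L.exists_factor ((L.mem_normalizer_iff y).mp hy)
    change (h₁ * L.scalar z₁ * (h₂ * L.scalar z₂))⁻¹ *
      (h₂ * L.scalar z₂ * (h₁ * L.scalar z₁)) ∈ H
    have e : ∀ a b z w, a * L.scalar z * (b * L.scalar w) = a * b * L.scalar (z * w) := by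
      intro a b z w
      rw [mul_assoc a, ← mul_assoc (L.scalar z), L.scalar_comm, map_mul]; group
    rw [e, e, mul_comm z₂ z₁, mul_inv_rev, ← map_inv, mul_assoc, L.scalar_comm, map_inv]
    have : (h₁ * h₂)⁻¹ * (h₂ * h₁ * L.scalar (z₁ * z₂)) * (L.scalar (z₁ * z₂))⁻¹ =
      (h₁ * h₂)⁻¹ * (h₂ * h₁) := by group
    rw [this]
    exact mul_mem (inv_mem (mul_mem hh₁ hh₂)) (mul_mem hh₂ hh₁)
  exists_key := by
    obtain ⟨b, hb, hbb⟩ := L.exists_swap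
    exact ⟨b, L.isHigmanKey hb hbb⟩

theorem index_normalizer (L : EquivariantLines H V n r) : (Subgroup.normalizer (H : Set Γ)).index = n := by
  let _ : MulAction Γ (Fin n) := MulAction.compHom (Fin n) L.perm
  have hs : Subgroup.normalizer (H : Set Γ) = MulAction.stabilizer Γ L.base :=
    Subgroup.ext fun g => L.mem_normalizer_iff g
  have : MulAction.IsPretransitive Γ (Fin n) := MulAction.isPretransitive_iff_base L.base |>.mpr
    fun i => L.exists_perm_base i
  rw [hs, MulAction.index_stabilizer_of_transitive, Nat.card_fin]

theorem relIndex_normalizer (L : EquivariantLines H V n r) [NeZero r] :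
    H.relIndex (Subgroup.normalizer (H : Set Γ)) = r := by
  let K := Subgroup.normalizer (H : Set Γ)
  let F : rootsOfUnity r ℂ → K ⧸ H.subgroupOf K := fun z =>
    ((⟨L.scalar z, (L.mem_normalizer_iff _).mpr (by rw [L.perm_scalar]; rfl)⟩ : K) :
      K ⧸ H.subgroupOf K)
  have hF : Function.Bijective F := by
    constructor
    · intro z w h
      have h1 := Subgroup.mem_subgroupOf.mp (QuotientGroup.eq.mp h)
      change (L.scalar z)⁻¹ * L.scalar w ∈ H at h1
      rw [← map_inv, ← map_mul, scalar_mem_iff, inv_mul_eq_one] at h1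
      exact h1
    · intro x
      obtain ⟨⟨x, hx⟩, rfl⟩ := QuotientGroup.mk_surjective x
      obtain ⟨h, hh, z, rfl⟩ := L.exists_factor ((L.mem_normalizer_iff x).mp hx)
      refine ⟨z, QuotientGroup.eq.mpr (Subgroup.mem_subgroupOf.mpr ?_)⟩
      change (L.scalar z)⁻¹ * (h * L.scalar z) ∈ H
      rw [← L.scalar_comm, inv_mul_cancel_left]
      exact hh
  rw [Subgroup.relIndex, Subgroup.index, ← Nat.card_congr (Equiv.ofBijective F hF),
    Complex.card_rootsOfUnity]

end EquivariantLines

/-! ### The adjacency algebra as the algebra of invariant matrices -/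

theorem schurianScheme_apply {Γ : Type*} [Group Γ] (H : Subgroup Γ) (R : Orbital H)
    (x y : Γ ⧸ H) [Decidable (Quotient.mk'' (x, y) = R)] :
    schurianScheme H R x y = if Quotient.mk'' (x, y) = R then 1 else 0 := by
  simp only [schurianScheme, MulAction.orbitRel.Quotient.mem_orbit]

theorem schurianScheme_smul {Γ : Type*} [Group Γ] (H : Subgroup Γ) (R : Orbital H) (g : Γ)
    (x y : Γ ⧸ H) : schurianScheme H R (g • x) (g • y) = schurianScheme H R x y := by
  classical
  rw [schurianScheme_apply, schurianScheme_apply]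
  have : (Quotient.mk'' (g • x, g • y) : Orbital H) = Quotient.mk'' (x, y) :=
    Quotient.sound' ⟨g, rfl⟩
  rw [this]

/-- An invariant matrix is the combination of the adjacency matrices with its own entries as
coefficients. -/
theorem eq_sum_schurianScheme {Γ : Type*} [Group Γ] {H : Subgroup Γ} [Fintype (Γ ⧸ H)]
    {M : Matrix (Γ ⧸ H) (Γ ⧸ H) ℂ} (hM : ∀ (g : Γ) x y, M (g • x) (g • y) = M x y) :
    M = ∑ R : Orbital H, M R.out.1 R.out.2 • schurianScheme H R := by
  classical
  ext x y
  rw [Matrix.sum_apply]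
  simp only [Matrix.smul_apply, schurianScheme_apply, smul_eq_mul, mul_ite, mul_one, mul_zero]
  rw [Finset.sum_ite_eq Finset.univ, if_pos (Finset.mem_univ _)]
  obtain ⟨g, hg⟩ : MulAction.orbitRel Γ _ (Quotient.mk'' (x, y) : Orbital H).out (x, y) :=
    Quotient.exact' (Quotient.out_eq' _)
  have h : g • (x, y) = (Quotient.mk'' (x, y) : Orbital H).out := hg
  rw [← h]
  exact (hM g x y).symm

theorem mem_adjacencyAlgebra_iff {Γ : Type*} [Group Γ] {H : Subgroup Γ} [Fintype (Γ ⧸ H)]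
    {M : Matrix (Γ ⧸ H) (Γ ⧸ H) ℂ} :
    M ∈ adjacencyAlgebra (schurianScheme H) ↔ ∀ (g : Γ) x y, M (g • x) (g • y) = M x y := by
  constructor
  · intro hM g x y
    induction hM using Submodule.span_induction with
    | mem M hM =>
      obtain ⟨R, rfl⟩ := hM
      exact schurianScheme_smul H R g x y
    | zero => rfl
    | add M N _ _ hM hN => rw [Matrix.add_apply, Matrix.add_apply, hM, hN]
    | smul c M _ hM => rw [Matrix.smul_apply, Matrix.smul_apply, hM]
  · intro hM
    rw [eq_sum_schurianScheme hM]
    exact Submodule.sum_mem _ fun R _ =>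
      Submodule.smul_mem _ _ (Submodule.subset_span (Set.mem_range_self R))

namespace EquivariantLines

variable {Γ : Type*} [Group Γ] {H : Subgroup Γ} {V : Type*}
    [NormedAddCommGroup V] [InnerProductSpace ℂ V] {n r : ℕ} (L : EquivariantLines H V n r)

/-! ### Commutativity of the scheme -/

/-- The permutation matrix of a central scalar. -/
noncomputable def scalarMatrix [DecidableEq (Γ ⧸ H)] (z : rootsOfUnity r ℂ) :
    Matrix (Γ ⧸ H) (Γ ⧸ H) ℂ :=
  fun x y => if y = L.scalar z • x then 1 else 0

theorem scalarMatrix_commute [DecidableEq (Γ ⧸ H)] [Fintype (Γ ⧸ H)] (z : rootsOfUnity r ℂ)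
    {M : Matrix (Γ ⧸ H) (Γ ⧸ H) ℂ} (hM : ∀ (g : Γ) x y, M (g • x) (g • y) = M x y) :
    Commute (L.scalarMatrix z) M := by
  ext x y
  rw [Matrix.mul_apply, Matrix.mul_apply]
  have h : ∀ w, (y = L.scalar z • w) ↔ w = (L.scalar z)⁻¹ • y := fun w => by
    rw [eq_inv_smul_iff, eq_comm]
  simp only [scalarMatrix, ite_mul, one_mul, zero_mul, mul_ite, mul_one, mul_zero, h,
    Finset.sum_ite_eq', Finset.mem_univ, if_true]
  rw [← hM (L.scalar z) x, smul_inv_smul]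

theorem mul_scalarMatrix_apply [DecidableEq (Γ ⧸ H)] [Fintype (Γ ⧸ H)] (z : rootsOfUnity r ℂ)
    (M : Matrix (Γ ⧸ H) (Γ ⧸ H) ℂ) (x y : Γ ⧸ H) :
    (M * L.scalarMatrix z) x y = M x ((L.scalar z)⁻¹ • y) := by
  have h : ∀ w, (y = L.scalar z • w) ↔ w = (L.scalar z)⁻¹ • y := fun w => by
    rw [eq_inv_smul_iff, eq_comm]
  rw [Matrix.mul_apply]
  simp only [scalarMatrix, mul_ite, mul_one, mul_zero, h,
    Finset.sum_ite_eq', Finset.mem_univ, if_true]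

/-- The orbital of the pair `(H, gH)`. -/
def orbitalOf (H : Subgroup Γ) (g : Γ) : Orbital H := Quotient.mk'' (((1 : Γ) : Γ ⧸ H), (g : Γ ⧸ H))

theorem mk_eq_orbitalOf (x y : Γ) :
    (Quotient.mk'' ((x : Γ ⧸ H), (y : Γ ⧸ H)) : Orbital H) = orbitalOf H (x⁻¹ * y) := by
  apply Quotient.sound'
  refine ⟨x, ?_⟩
  change (((x * 1 : Γ) : Γ ⧸ H), ((x * (x⁻¹ * y) : Γ) : Γ ⧸ H)) = ((x : Γ ⧸ H), (y : Γ ⧸ H))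
  rw [mul_one, mul_inv_cancel_left]

/-- This identifies the relations of the scheme with the `H`-double cosets, so coefficient arguments
on `Γ` apply to them. -/
theorem orbitalOf_eq_iff {g g' : Γ} :
    orbitalOf H g = orbitalOf H g' ↔ ∃ h₁ ∈ H, ∃ h₂ ∈ H, g' = h₁ * g * h₂ := by
  constructor
  · intro h
    obtain ⟨k, hk⟩ := Quotient.exact' h
    have hk1 : ((k * 1 : Γ) : Γ ⧸ H) = (1 : Γ) := congrArg Prod.fst hk
    have hk2 : ((k * g' : Γ) : Γ ⧸ H) = (g : Γ) := congrArg Prod.snd hk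
    rw [eq_comm, QuotientGroup.eq] at hk1 hk2
    refine ⟨k⁻¹, ?_, g⁻¹ * (k * g'), hk2, by group⟩
    simpa using inv_mem hk1
  · rintro ⟨h₁, hh₁, h₂, hh₂, rfl⟩
    symm
    apply Quotient.sound'
    refine ⟨h₁, Prod.ext ?_ ?_⟩
    · change ((h₁ * 1 : Γ) : Γ ⧸ H) = (1 : Γ)
      rw [eq_comm, QuotientGroup.eq]
      simpa using hh₁
    · change ((h₁ * g : Γ) : Γ ⧸ H) = (h₁ * g * h₂ : Γ)
      rw [QuotientGroup.eq]
      simpa [mul_assoc] using hh₂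

theorem orbitalOf_surjective (R : Orbital H) : ∃ g, R = orbitalOf H g := by
  obtain ⟨⟨x, y⟩, rfl⟩ := Quotient.mk''_surjective R
  obtain ⟨x, rfl⟩ := QuotientGroup.mk_surjective x
  obtain ⟨y, rfl⟩ := QuotientGroup.mk_surjective y
  exact ⟨_, mk_eq_orbitalOf x y⟩

theorem schurianScheme_eq_scalarMatrix [DecidableEq (Γ ⧸ H)] (z : rootsOfUnity r ℂ) :
    schurianScheme H (orbitalOf H (L.scalar z)) = L.scalarMatrix z := by
  classical
  ext x y
  obtain ⟨x, rfl⟩ := QuotientGroup.mk_surjective x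
  obtain ⟨y, rfl⟩ := QuotientGroup.mk_surjective y
  rw [schurianScheme_apply, scalarMatrix]
  refine if_congr ?_ rfl rfl
  rw [mk_eq_orbitalOf, eq_comm, orbitalOf_eq_iff, MulAction.Quotient.smul_coe,
    eq_comm (a := (y : Γ ⧸ H)), QuotientGroup.eq, smul_eq_mul, L.scalar_comm]
  constructor
  · rintro ⟨h₁, hh₁, h₂, hh₂, h⟩
    have : (x * L.scalar z)⁻¹ * y = (L.scalar z)⁻¹ * (x⁻¹ * y) := by group
    rw [this, h, ← L.scalar_comm, mul_assoc, inv_mul_cancel_left]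
    exact mul_mem hh₁ hh₂
  · intro h
    exact ⟨1, one_mem H, _, h, by group⟩

theorem schurianScheme_mul_scalarMatrix [DecidableEq (Γ ⧸ H)] [Fintype (Γ ⧸ H)] (g : Γ)
    (z : rootsOfUnity r ℂ) :
    schurianScheme H (orbitalOf H (g * L.scalar z)) =
      schurianScheme H (orbitalOf H g) * L.scalarMatrix z := by
  classical
  ext x y
  rw [mul_scalarMatrix_apply]
  obtain ⟨x, rfl⟩ := QuotientGroup.mk_surjective x
  obtain ⟨y, rfl⟩ := QuotientGroup.mk_surjective y
  rw [MulAction.Quotient.smul_coe, schurianScheme_apply, schurianScheme_apply]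
  refine if_congr ?_ rfl rfl
  rw [mk_eq_orbitalOf, mk_eq_orbitalOf, eq_comm, orbitalOf_eq_iff,
    eq_comm (a := orbitalOf H (x⁻¹ * _)), orbitalOf_eq_iff]
  have e : x⁻¹ * ((L.scalar z)⁻¹ • y) = x⁻¹ * y * (L.scalar z)⁻¹ := by
    rw [smul_eq_mul, ← map_inv, L.scalar_comm, mul_assoc]
  have e' : ∀ h₁ h₂, h₁ * (g * L.scalar z) * h₂ = h₁ * g * h₂ * L.scalar z := by
    intro h₁ h₂
    rw [mul_assoc, mul_assoc g, L.scalar_comm]; group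
  simp only [e, e', mul_inv_eq_iff_eq_mul]

/-- Every adjacency matrix is a scalar permutation matrix or the single matrix `B` times one, and
the scalar matrices commute with all invariant matrices. -/
theorem isCommutativeScheme [Fintype (Γ ⧸ H)] (L : EquivariantLines H V n r) :
    IsCommutativeScheme (schurianScheme H) := by
  classical
  obtain ⟨b, hb, -⟩ := L.exists_swap
  set B := schurianScheme H (orbitalOf H b) with hB
  have hinv := schurianScheme_smul (Γ := Γ) H
  have hcase : ∀ R, (∃ z, schurianScheme H R = L.scalarMatrix z) ∨
      ∃ z, schurianScheme H R = B * L.scalarMatrix z := by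
    intro R
    obtain ⟨g, rfl⟩ := orbitalOf_surjective R
    by_cases hg : L.perm g L.base = L.base
    · left
      obtain ⟨h, hh, z, rfl⟩ := L.exists_factor hg
      refine ⟨z, ?_⟩
      rw [← schurianScheme_eq_scalarMatrix]
      congr 1
      exact (orbitalOf_eq_iff.mpr ⟨h, hh, 1, one_mem H, (mul_one _).symm⟩).symm
    · right
      obtain ⟨h₁, hh₁, h₂, hh₂, z, rfl⟩ := L.exists_doubleCoset hb hg
      refine ⟨z, ?_⟩
      rw [schurianScheme_mul_scalarMatrix]
      congr 2
      exact (orbitalOf_eq_iff.mpr ⟨h₁, hh₁, h₂, hh₂, rfl⟩).symm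
  have hgen : ∀ R S, Commute (schurianScheme H R) (schurianScheme H S) := by
    intro R S
    rcases hcase R with ⟨z, hz⟩ | ⟨z, hz⟩
    · rw [hz]
      exact L.scalarMatrix_commute z (hinv S)
    · rcases hcase S with ⟨w, hw⟩ | ⟨w, hw⟩
      · rw [hw]
        exact (L.scalarMatrix_commute w (hinv R)).symm
      · have h1 : Commute (L.scalarMatrix z) B := L.scalarMatrix_commute z (hinv _)
        have h2 : Commute (L.scalarMatrix w) B := L.scalarMatrix_commute w (hinv _)
        have h3 : Commute (L.scalarMatrix z) (L.scalarMatrix w) := by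
          rw [← L.schurianScheme_eq_scalarMatrix w]
          exact L.scalarMatrix_commute z (hinv _)
        rw [hz, hw]
        exact ((Commute.refl B).mul_right h2.symm).mul_left (h1.mul_right h3)
  intro M hM N hN
  induction hM, hN using Submodule.span_induction₂ with
  | mem_mem M N hM hN =>
    obtain ⟨R, rfl⟩ := hM
    obtain ⟨S, rfl⟩ := hN
    exact hgen R S
  | zero_left => rw [zero_mul, mul_zero]
  | zero_right => rw [zero_mul, mul_zero]
  | add_left M M' N _ _ _ h h' => rw [add_mul, mul_add, h, h']
  | add_right M N N' _ _ _ h h' => rw [add_mul, mul_add, h, h']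
  | smul_left c M N _ _ h => rw [Matrix.smul_mul, Matrix.mul_smul, h]
  | smul_right c M N _ _ h => rw [Matrix.smul_mul, Matrix.mul_smul, h]

/-! ### Irreducibility -/

theorem linearIndependent_of_inner {ι : Type*} [Fintype ι] {v : ι → V} {T : V →ₗ[ℂ] V} {β : ℂ}
    (hβ : β ≠ 0) (hdiag : ∀ i, inner ℂ (v i) (T (v i)) = β)
    (hoff : ∀ i j, i ≠ j → inner ℂ (v i) (T (v j)) = 0) : LinearIndependent ℂ v := by
  classical
  rw [Fintype.linearIndependent_iff]
  intro c hc i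
  have h : inner ℂ (v i) (T (∑ j, c j • v j)) = c i * β := by
    rw [map_sum, inner_sum, Finset.sum_eq_single i]
    · rw [map_smul, inner_smul_right, hdiag]
    · intro j _ hj
      rw [map_smul, inner_smul_right, hoff i j hj.symm, mul_zero]
    · intro h
      exact absurd (Finset.mem_univ i) h
  rw [hc, map_zero, inner_zero_right] at h
  exact (mul_eq_zero.mp h.symm).resolve_right hβ

/-- A Schur-type argument by dimension count. A multiple of the identity is subtracted so that the
matrix of `D` on the orbit vanishes between distinct lines. Were its diagonal value nonzero, one
vector per line would give `n` independent vectors in dimension less than `n`. So `D` vanishes on a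
spanning set. -/
theorem exists_smul_of_commute [FiniteDimensional ℂ V] {T : V →ₗ[ℂ] V}
    (hT : ∀ g u, T (L.rep g u) = L.rep g (T u)) : ∃ a : ℂ, ∀ u, T u = a • u := by
  obtain ⟨b, hb, -⟩ := L.exists_swap
  -- This value makes `⟪v, D (b v)⟫` zero; one double coset suffices, since the other elements
  -- moving the base line differ from `b` by `H` and scalars.
  set a : ℂ := inner ℂ L.vec (T (L.rep b L.vec)) / L.coeff b with ha
  let D : V →ₗ[ℂ] V := T - a • LinearMap.id
  have hD : ∀ g u, D (L.rep g u) = L.rep g (D u) := by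
    intro g u
    simp only [D, LinearMap.sub_apply, LinearMap.smul_apply, LinearMap.id_apply, hT, map_sub,
      map_smul]
  have hDb : inner ℂ L.vec (D (L.rep b L.vec)) = 0 := by
    simp only [D, LinearMap.sub_apply, LinearMap.smul_apply, LinearMap.id_apply]
    rw [inner_sub_right, inner_smul_right, ha]
    change _ - _ / L.coeff b * L.coeff b = 0
    rw [div_mul_cancel₀ (b := L.coeff b) _ (L.inner_ne_zero b), sub_self]
  have hmove : ∀ g g', inner ℂ (L.rep g L.vec) (D (L.rep g' L.vec)) =
      inner ℂ L.vec (D (L.rep (g⁻¹ * g') L.vec)) := by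
    intro g g'
    rw [inner_rep_left, ← hD, ← rep_mul_apply]
  have hoff : ∀ g, L.perm g L.base ≠ L.base → inner ℂ L.vec (D (L.rep g L.vec)) = 0 := by
    intro g hg
    obtain ⟨h₁, hh₁, h₂, hh₂, z, rfl⟩ := L.exists_doubleCoset hb hg
    rw [rep_mul_apply, L.rep_scalar, map_smul, map_smul, inner_smul_right, rep_mul_apply,
      L.rep_vec_of_mem hh₂, ← inv_inv h₁, ← hmove, L.rep_vec_of_mem (inv_mem hh₁), hDb, mul_zero]
  choose γ hγ using L.exists_perm_base
  have hβ : inner ℂ L.vec (D L.vec) = 0 := by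
    by_contra hne
    have hli := linearIndependent_of_inner (v := fun i => L.rep (γ i) L.vec) hne
      (fun i => by rw [hmove, inv_mul_cancel, map_one, Module.End.one_apply])
      (fun i j hij => by
        rw [hmove]
        apply hoff
        rw [perm_mul_apply, map_inv, hγ, Ne, Equiv.Perm.inv_eq_iff_eq, hγ]
        exact hij.symm)
    have := hli.fintype_card_le_finrank
    rw [Fintype.card_fin] at this
    exact absurd L.finrank_lt (not_lt.mpr this)
  have hall : ∀ g g', inner ℂ (L.rep g L.vec) (D (L.rep g' L.vec)) = 0 := by
    intro g g'
    rw [hmove]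
    by_cases hg : L.perm (g⁻¹ * g') L.base = L.base
    · obtain ⟨z, hz⟩ := L.exists_phase _ hg
      rw [hz, map_smul, inner_smul_right, hβ, mul_zero]
    · exact hoff _ hg
  have hD0 : D = 0 := by
    apply LinearMap.ext_on L.span_orbit
    rintro _ ⟨g', rfl⟩
    have hle : (⊤ : Submodule ℂ V) ≤ (ℂ ∙ D (L.rep g' L.vec))ᗮ := by
      rw [← L.span_orbit, Submodule.span_le]
      rintro _ ⟨g, rfl⟩
      exact Submodule.mem_orthogonal_singleton_iff_inner_left.mpr (hall g g')
    exact inner_self_eq_zero.mp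
      (Submodule.mem_orthogonal_singleton_iff_inner_left.mp (hle Submodule.mem_top))
  refine ⟨a, fun u => ?_⟩
  have := LinearMap.congr_fun hD0 u
  simpa [D, sub_eq_zero] using this

end EquivariantLines

namespace EquivariantLines

variable {Γ : Type*} [Group Γ] {H : Subgroup Γ} {V : Type*}
    [NormedAddCommGroup V] [InnerProductSpace ℂ V] {n r : ℕ} (L : EquivariantLines H V n r)

/-! ### The primitive idempotent -/

/-- The orbit of the base vector, indexed by the cosets of its stabilizer. -/
def orbitVec : Γ ⧸ H → V :=
  Quotient.lift (fun g : Γ => L.rep g L.vec) (by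
    intro g g' h
    have h1 : g⁻¹ * g' ∈ H := QuotientGroup.leftRel_apply.mp h
    have h2 : L.rep (g * (g⁻¹ * g')) L.vec = L.rep g L.vec := by
      rw [rep_mul_apply, L.rep_vec_of_mem h1]
    rw [mul_inv_cancel_left] at h2
    exact h2.symm)

theorem orbitVec_mk (g : Γ) : L.orbitVec (g : Γ ⧸ H) = L.rep g L.vec := rfl

theorem orbitVec_smul (g : Γ) (x : Γ ⧸ H) : L.orbitVec (g • x) = L.rep g (L.orbitVec x) := by
  obtain ⟨x, rfl⟩ := QuotientGroup.mk_surjective x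
  rw [MulAction.Quotient.smul_coe, orbitVec_mk, orbitVec_mk, smul_eq_mul, rep_mul_apply]

theorem inner_orbitVec_mk (x y : Γ) :
    inner ℂ (L.orbitVec (x : Γ ⧸ H)) (L.orbitVec (y : Γ ⧸ H)) = L.coeff (x⁻¹ * y) := by
  rw [orbitVec_mk, orbitVec_mk, inner_rep_left, ← rep_mul_apply, coeff]

theorem norm_rep_vec (g : Γ) : ‖L.rep g L.vec‖ = 1 := by
  have h := L.inner_rep g L.vec L.vec
  rw [inner_self_eq_norm_sq_to_K, inner_self_eq_norm_sq_to_K, L.norm_vec] at h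
  have h' : ‖L.rep g L.vec‖ ^ 2 = 1 ^ 2 := by exact_mod_cast h
  exact (pow_left_inj₀ (norm_nonneg _) zero_le_one two_ne_zero).mp h'

/-- The Gram matrix of the orbit. -/
noncomputable def gram : Matrix (Γ ⧸ H) (Γ ⧸ H) ℂ :=
  fun x y => inner ℂ (L.orbitVec x) (L.orbitVec y)

theorem gram_smul (g : Γ) (x y : Γ ⧸ H) : L.gram (g • x) (g • y) = L.gram x y := by
  rw [gram, orbitVec_smul, orbitVec_smul, L.inner_rep, gram]

theorem gram_conjTranspose : (L.gram)ᴴ = L.gram := by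
  ext x y
  exact inner_conj_symm _ _

theorem gram_mk (x y : Γ) : L.gram (x : Γ ⧸ H) (y : Γ ⧸ H) = L.coeff (x⁻¹ * y) :=
  L.inner_orbitVec_mk x y

theorem gram_ne_zero : L.gram ≠ 0 := by
  intro h
  have := congrFun (congrFun h ((1 : Γ) : Γ ⧸ H)) ((1 : Γ) : Γ ⧸ H)
  rw [gram_mk, inv_mul_cancel, coeff_one] at this
  exact one_ne_zero this

/-- The orbit consists of `r` vectors on each of the `n` lines. -/
theorem exists_equiv [NeZero r] (L : EquivariantLines H V n r) {γ : Fin n → Γ}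
    (hγ : ∀ i, L.perm (γ i) L.base = i) :
    ∃ e : Γ ⧸ H ≃ Fin n × rootsOfUnity r ℂ,
      ∀ x, x = ((γ (e x).1 * L.scalar (e x).2 : Γ) : Γ ⧸ H) := by
  let F : Fin n × rootsOfUnity r ℂ → Γ ⧸ H := fun p => ((γ p.1 * L.scalar p.2 : Γ) : Γ ⧸ H)
  have hF : Function.Bijective F := by
    constructor
    · rintro ⟨i, z⟩ ⟨j, w⟩ h
      have h1 : (γ i * L.scalar z)⁻¹ * (γ j * L.scalar w) ∈ H := QuotientGroup.eq.mp h
      have hij : i = j := by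
        have h2 := L.perm_of_mem h1
        rw [perm_mul_apply, perm_mul_apply, L.perm_scalar, Equiv.Perm.one_apply, hγ, map_inv,
          Equiv.Perm.inv_eq_iff_eq, perm_mul_apply, L.perm_scalar, Equiv.Perm.one_apply, hγ] at h2
        exact h2.symm
      subst hij
      have h3 : (γ i * L.scalar z)⁻¹ * (γ i * L.scalar w) = L.scalar (z⁻¹ * w) := by
        rw [map_mul, map_inv]; group
      rw [h3, scalar_mem_iff, inv_mul_eq_one] at h1
      rw [h1]
    · intro x
      obtain ⟨x, rfl⟩ := QuotientGroup.mk_surjective x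
      have hx : L.perm ((γ (L.perm x L.base))⁻¹ * x) L.base = L.base := by
        rw [perm_mul_apply, map_inv, Equiv.Perm.inv_eq_iff_eq, hγ]
      obtain ⟨h, hh, z, hz⟩ := L.exists_factor hx
      refine ⟨(L.perm x L.base, z), QuotientGroup.eq.mpr ?_⟩
      have : (γ (L.perm x L.base) * L.scalar z)⁻¹ * x = (L.scalar z)⁻¹ * (h * L.scalar z) := by
        rw [← hz]; group
      rw [this, ← L.scalar_comm, inv_mul_cancel_left]
      exact hh
  refine ⟨(Equiv.ofBijective F hF).symm, fun x => ?_⟩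
  exact ((Equiv.ofBijective F hF).apply_symm_apply x).symm

theorem isGramOfRepresentatives [NeZero r] {d : ℕ}
    (L : EquivariantLines H (EuclideanSpace ℂ (Fin d)) n r)
    {ℓ : Fin n → Submodule ℂ (EuclideanSpace ℂ (Fin d))}
    (hℓ : ∀ g, Submodule.span ℂ {L.rep g L.vec} = ℓ (L.perm g L.base))
    {c : ℝ} (hc : 0 < c) : IsGramOfRepresentatives ℓ r ((c : ℂ) • L.gram) := by
  choose γ hγ using L.exists_perm_base
  obtain ⟨e, he⟩ := L.exists_equiv hγ
  let ε : Fin r ≃ rootsOfUnity r ℂ := (Finite.equivFinOfCardEq (Complex.card_rootsOfUnity r)).symm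
  -- Scaling the vectors by `√c` scales their Gram matrix by `c`.
  let s : ℂ := ((Real.sqrt c : ℝ) : ℂ)
  have hs : s ≠ 0 := Complex.ofReal_ne_zero.mpr (Real.sqrt_pos.mpr hc).ne'
  refine ⟨e.trans (Equiv.prodCongr (Equiv.refl _) ε.symm),
    fun i k => s • L.rep (γ i * L.scalar (ε k)) L.vec, ?_, ?_, ?_, ?_⟩
  · intro i k
    rw [Submodule.span_singleton_smul_eq hs.isUnit, hℓ, perm_mul_apply, L.perm_scalar,
      Equiv.Perm.one_apply, hγ]
  · intro i k l h
    have h1 : L.rep (γ i * L.scalar (ε k)) L.vec = L.rep (γ i * L.scalar (ε l)) L.vec :=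
      smul_right_injective _ hs h
    have h2 := congrArg (L.rep (γ i)⁻¹) h1
    rw [rep_mul_apply, rep_mul_apply, rep_inv_rep, rep_inv_rep, L.rep_scalar, L.rep_scalar] at h2
    exact ε.injective (Subtype.ext (Units.ext (smul_left_injective ℂ L.vec_ne_zero h2)))
  · intro i k j l
    rw [norm_smul, norm_smul, norm_rep_vec, norm_rep_vec]
  · intro x y
    rw [Matrix.smul_apply, gram]
    conv_lhs => rw [he x, he y]
    simp only [Equiv.trans_apply, Equiv.prodCongr_apply, Prod.map, Equiv.refl_apply,
      Equiv.apply_symm_apply, orbitVec_mk]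
    rw [inner_smul_left, inner_smul_right, smul_eq_mul, ← mul_assoc]
    congr 1
    rw [Complex.conj_ofReal, ← Complex.ofReal_mul, Real.mul_self_sqrt hc.le]

variable [Fintype (Γ ⧸ H)]

/-- The operator `∑ P x y |x⟩⟨y|` of a matrix `P`, where `|x⟩` runs through the orbit. -/
noncomputable def operator (P : Matrix (Γ ⧸ H) (Γ ⧸ H) ℂ) : V →ₗ[ℂ] V :=
  ∑ x, ∑ y, P x y • (innerSL ℂ (L.orbitVec y)).toLinearMap.smulRight (L.orbitVec x)

theorem operator_apply (P : Matrix (Γ ⧸ H) (Γ ⧸ H) ℂ) (u : V) :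
    L.operator P u = ∑ x, ∑ y, P x y • inner ℂ (L.orbitVec y) u • L.orbitVec x := by
  simp [operator, LinearMap.sum_apply]

theorem operator_rep {P : Matrix (Γ ⧸ H) (Γ ⧸ H) ℂ}
    (hP : ∀ (g : Γ) x y, P (g • x) (g • y) = P x y) (g : Γ) (u : V) :
    L.operator P (L.rep g u) = L.rep g (L.operator P u) := by
  rw [operator_apply, operator_apply, map_sum,
    ← Equiv.sum_comp (MulAction.toPerm (α := Γ) (β := Γ ⧸ H) g)]
  refine Finset.sum_congr rfl fun x _ => ?_
  rw [map_sum, ← Equiv.sum_comp (MulAction.toPerm (α := Γ) (β := Γ ⧸ H) g)]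
  refine Finset.sum_congr rfl fun y _ => ?_
  rw [MulAction.toPerm_apply, MulAction.toPerm_apply, hP, orbitVec_smul, orbitVec_smul,
    L.inner_rep, map_smul, map_smul]

/-- With `S` the synthesis map of the orbit, the Gram matrix is `S* S` and the operator of `P` is `S
P S*`, so compression by the Gram matrix becomes `S* (S P S*) S`. -/
theorem gram_mul_mul_gram (P : Matrix (Γ ⧸ H) (Γ ⧸ H) ℂ) (x y : Γ ⧸ H) :
    (L.gram * P * L.gram) x y = inner ℂ (L.orbitVec x) (L.operator P (L.orbitVec y)) := by
  rw [operator_apply, inner_sum, Matrix.mul_assoc, Matrix.mul_apply]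
  refine Finset.sum_congr rfl fun z _ => ?_
  rw [inner_sum, Matrix.mul_apply, Finset.mul_sum]
  refine Finset.sum_congr rfl fun w _ => ?_
  rw [inner_smul_right, inner_smul_right, gram, gram]
  ring

/-- Every invariant matrix, compressed by the Gram matrix, is a multiple of the Gram matrix. -/
theorem exists_gram_mul_mul_gram [FiniteDimensional ℂ V] {P : Matrix (Γ ⧸ H) (Γ ⧸ H) ℂ}
    (hP : ∀ (g : Γ) x y, P (g • x) (g • y) = P x y) :
    ∃ a : ℂ, L.gram * P * L.gram = a • L.gram := by
  obtain ⟨a, ha⟩ := L.exists_smul_of_commute (L.operator_rep hP)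
  refine ⟨a, ?_⟩
  ext x y
  rw [gram_mul_mul_gram, ha, inner_smul_right]
  rfl

theorem exists_gram_mul_gram [FiniteDimensional ℂ V] :
    ∃ a : ℝ, 0 < a ∧ L.gram * L.gram = (a : ℂ) • L.gram := by
  classical
  obtain ⟨a, ha⟩ := L.exists_gram_mul_mul_gram (P := 1) (fun g x y => by
    rw [Matrix.one_apply, Matrix.one_apply]
    exact if_congr (MulAction.injective g).eq_iff rfl rfl)
  rw [Matrix.mul_one] at ha
  have h := congrFun (congrFun ha ((1 : Γ) : Γ ⧸ H)) ((1 : Γ) : Γ ⧸ H)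
  rw [Matrix.smul_apply, gram_mk, inv_mul_cancel, coeff_one, smul_eq_mul, mul_one,
    Matrix.mul_apply] at h
  -- A diagonal entry of the squared Gram matrix is the sum of squared moduli along a row. As the
  -- Gram diagonal is 1, this sum is `a`, which is therefore real and positive.
  have h' : ((∑ z, Complex.normSq (L.gram ((1 : Γ) : Γ ⧸ H) z) : ℝ) : ℂ) = a := by
    rw [← h, Complex.ofReal_sum]
    refine Finset.sum_congr rfl fun z _ => ?_
    rw [← Complex.mul_conj]
    congr 1
    exact inner_conj_symm _ _
  refine ⟨_, ?_, by rw [h', ha]⟩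
  refine Finset.sum_pos (fun z _ => ?_) ⟨((1 : Γ) : Γ ⧸ H), Finset.mem_univ _⟩
  obtain ⟨z, rfl⟩ := QuotientGroup.mk_surjective z
  rw [Complex.normSq_pos, gram_mk]
  exact L.inner_ne_zero _

theorem isPrimitiveIdempotent [FiniteDimensional ℂ V] {a : ℝ} (ha : 0 < a)
    (hg : L.gram * L.gram = (a : ℂ) • L.gram) :
    IsPrimitiveIdempotent (schurianScheme H) (((a⁻¹ : ℝ) : ℂ) • L.gram) := by
  have ha' : (a : ℂ) ≠ 0 := Complex.ofReal_ne_zero.mpr ha.ne'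
  have hc : ((a⁻¹ : ℝ) : ℂ) ≠ 0 := Complex.ofReal_ne_zero.mpr (inv_ne_zero ha.ne')
  have hmem : ((a⁻¹ : ℝ) : ℂ) • L.gram ∈ adjacencyAlgebra (schurianScheme H) :=
    Submodule.smul_mem _ _ (mem_adjacencyAlgebra_iff.mpr L.gram_smul)
  have hE0 : ((a⁻¹ : ℝ) : ℂ) • L.gram ≠ 0 := smul_ne_zero hc L.gram_ne_zero
  have hEE : ((a⁻¹ : ℝ) : ℂ) • L.gram * ((a⁻¹ : ℝ) : ℂ) • L.gram = ((a⁻¹ : ℝ) : ℂ) • L.gram := by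
    rw [Matrix.smul_mul, Matrix.mul_smul, hg, smul_smul, smul_smul, Complex.ofReal_inv,
      mul_assoc, inv_mul_cancel₀ ha', mul_one]
  refine ⟨L.isCommutativeScheme, ⟨hmem, ?_, hEE⟩, hE0, ?_⟩
  · rw [Matrix.conjTranspose_smul, gram_conjTranspose]
    congr 1
    exact Complex.conj_ofReal _
  · rintro P ⟨hPmem, -, hPP⟩ hEP
    set E := ((a⁻¹ : ℝ) : ℂ) • L.gram with hE
    have hPE : P * E = P := by rw [← L.isCommutativeScheme _ hmem _ hPmem, hEP]
    obtain ⟨c, hcP⟩ := L.exists_gram_mul_mul_gram (mem_adjacencyAlgebra_iff.mp hPmem)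
    -- A projection below `E` equals its own compression `E * P * E`, hence is a multiple of `E`;
    -- idempotence leaves only the factors 0 and 1.
    have hPc : P = (((a⁻¹ : ℝ) : ℂ) * c) • E := by
      calc P = E * P * E := by rw [hEP, hPE]
        _ = _ := by
          rw [hE, Matrix.smul_mul, Matrix.smul_mul, Matrix.mul_smul, hcP]
          simp only [smul_smul]
          congr 1
          ring
    generalize ((a⁻¹ : ℝ) : ℂ) * c = s at hPc
    have hs : (s * s) • E = s • E := by
      have := hPP
      rw [hPc, Matrix.smul_mul, Matrix.mul_smul, hEE, smul_smul] at this
      exact this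
    have hs' : s * s = s := smul_left_injective ℂ hE0 hs
    rcases IsIdempotentElem.iff_eq_zero_or_one.mp hs' with rfl | rfl
    · left; rw [hPc, zero_smul]
    · right; rw [hPc, one_smul]

/-- Modulus 1 separates pairs on a common line from pairs on different lines. Within each of the two
kinds, the coefficient determines the scalar and hence the double coset. -/
theorem carriesScheme {c : ℂ} (hc : c ≠ 0)
    (hnorm : ∀ g, L.perm g L.base ≠ L.base → ‖L.coeff g‖ ≠ 1) :
    CarriesScheme (schurianScheme H) (c • L.gram) := by
  have hval : ∀ g : Γ, L.gram (orbitalOf H g).out.1 (orbitalOf H g).out.2 = L.coeff g := by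
    intro g
    obtain ⟨k, hk⟩ : MulAction.orbitRel Γ _ (orbitalOf H g).out
        (((1 : Γ) : Γ ⧸ H), (g : Γ ⧸ H)) := Quotient.exact' (Quotient.out_eq' _)
    rw [← hk]
    change L.gram (k • _) (k • _) = _
    rw [gram_smul, gram_mk, inv_one, one_mul]
  have hphase : ∀ g, L.perm g L.base = L.base → ‖L.coeff g‖ = 1 := by
    intro g hg
    obtain ⟨z, hz⟩ := L.exists_phase g hg
    have h1 := L.norm_rep_vec g
    rw [hz, norm_smul, L.norm_vec, mul_one] at h1
    rw [coeff, hz, inner_smul_right, inner_self_eq_norm_sq_to_K, L.norm_vec, norm_mul, h1]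
    simp
  refine ⟨fun R => c * L.gram R.out.1 R.out.2, ?_, ?_⟩
  · intro R S hRS
    obtain ⟨g, rfl⟩ := orbitalOf_surjective R
    obtain ⟨g', rfl⟩ := orbitalOf_surjective S
    have h := mul_left_cancel₀ hc hRS
    rw [hval, hval] at h
    rw [orbitalOf_eq_iff]
    by_cases hg : L.perm g L.base = L.base
    · have hg' : L.perm g' L.base = L.base := by
        by_contra hg'
        exact hnorm g' hg' (by rw [← h, hphase g hg])
      obtain ⟨h₁, hh₁, z, rfl⟩ := L.exists_factor hg
      obtain ⟨h₂, hh₂, w, rfl⟩ := L.exists_factor hg'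
      have e := L.coeff_mul_of_perm hh₁ rfl 1 (z := z)
      have e' := L.coeff_mul_of_perm hh₂ rfl 1 (z := w)
      rw [mul_one, coeff_one, mul_one] at e e'
      rw [e, e'] at h
      have : z = w := Subtype.ext (Units.ext h)
      subst this
      exact ⟨h₂ * h₁⁻¹, mul_mem hh₂ (inv_mem hh₁), 1, one_mem H, by group⟩
    · have hg' : L.perm g' L.base ≠ L.base := by
        intro hg'
        exact hnorm g hg (by rw [h, hphase g' hg'])
      exact L.exists_doubleCoset_of_coeff_eq hg hg' h.symm
  · conv_lhs => rw [eq_sum_schurianScheme L.gram_smul, Finset.smul_sum]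
    simp only [smul_smul]

end EquivariantLines

/-! ### Unitaries permuting lines -/

section Lines

variable {V : Type*} [NormedAddCommGroup V] [InnerProductSpace ℂ V]

theorem exists_unit_span {S : Submodule ℂ V} (hS : Module.finrank ℂ S = 1) :
    ∃ v : V, ‖v‖ = 1 ∧ Submodule.span ℂ {v} = S := by
  obtain ⟨⟨w, hw⟩, hw0, h⟩ := finrank_eq_one_iff'.mp hS
  have hw0' : w ≠ 0 := fun h => hw0 (Subtype.ext h)
  have hn : (((‖w‖⁻¹ : ℝ) : ℂ)) ≠ 0 :=
    Complex.ofReal_ne_zero.mpr (inv_ne_zero (norm_ne_zero_iff.mpr hw0'))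
  refine ⟨((‖w‖⁻¹ : ℝ) : ℂ) • w, ?_, ?_⟩
  · rw [norm_smul, Complex.norm_real, norm_inv, norm_norm,
      inv_mul_cancel₀ (norm_ne_zero_iff.mpr hw0')]
  · rw [Submodule.span_singleton_smul_eq hn.isUnit]
    apply le_antisymm
    · rw [Submodule.span_singleton_le_iff_mem]
      exact hw
    · intro u hu
      obtain ⟨c, hc⟩ := h ⟨u, hu⟩
      exact Submodule.mem_span_singleton.mpr ⟨c, congrArg Subtype.val hc⟩

theorem circle_smul_eq_coe_smul (z : Circle) (v : V) : z • v = (z : ℂ) • v := rfl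

theorem circle_smul_right_injective {v : V} (hv : ‖v‖ = 1) {z w : Circle}
    (h : z • v = w • v) : z = w :=
  Circle.ext (smul_left_injective ℂ (norm_ne_zero_iff.mp (by rw [hv]; exact one_ne_zero)) h)

theorem exists_circle_smul {v w : V} (hv : ‖v‖ = 1) (hw : ‖w‖ = 1)
    (h : w ∈ Submodule.span ℂ {v}) : ∃ z : Circle, w = z • v := by
  obtain ⟨c, rfl⟩ := Submodule.mem_span_singleton.mp h
  have hc : ‖c‖ = 1 := by rwa [norm_smul, hv, mul_one] at hw
  exact ⟨⟨c, mem_sphere_zero_iff_norm.mpr hc⟩, rfl⟩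

variable {n : ℕ} {ℓ : Fin n → Submodule ℂ V} {v : Fin n → V}

theorem exists_phase_of_map (hv : ∀ i, ‖v i‖ = 1) (hvℓ : ∀ i, Submodule.span ℂ {v i} = ℓ i)
    {Q : V ≃ₗᵢ[ℂ] V} {σ : Fin n → Fin n}
    (hQ : ∀ i, (ℓ i).map (Q.toLinearEquiv : V →ₗ[ℂ] V) = ℓ (σ i)) (i : Fin n) :
    ∃ z : Circle, Q (v i) = z • v (σ i) := by
  apply exists_circle_smul (hv _) (by rw [Q.norm_map, hv])
  rw [hvℓ, ← hQ, ← hvℓ]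
  exact Submodule.mem_map_of_mem (Submodule.mem_span_singleton_self _)

theorem norm_inner_of_map (hv : ∀ i, ‖v i‖ = 1) (hvℓ : ∀ i, Submodule.span ℂ {v i} = ℓ i)
    {Q : V ≃ₗᵢ[ℂ] V} {σ : Fin n → Fin n}
    (hQ : ∀ i, (ℓ i).map (Q.toLinearEquiv : V →ₗ[ℂ] V) = ℓ (σ i)) (i j : Fin n) :
    ‖(inner ℂ (v (σ i)) (v (σ j)) : ℂ)‖ = ‖(inner ℂ (v i) (v j) : ℂ)‖ := by
  obtain ⟨z, hz⟩ := exists_phase_of_map hv hvℓ hQ i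
  obtain ⟨w, hw⟩ := exists_phase_of_map hv hvℓ hQ j
  rw [← Q.inner_map_map (v i), hz, hw, circle_smul_eq_coe_smul, circle_smul_eq_coe_smul,
    inner_smul_left, inner_smul_right, norm_mul, norm_mul, RCLike.norm_conj, Circle.norm_coe,
    Circle.norm_coe, one_mul, one_mul]

/-- If no two lines are orthogonal, then a unitary operator is determined up to a phase by its
action on the lines. -/
theorem exists_phase_of_map_eq [NeZero n] (hv : ∀ i, ‖v i‖ = 1)
    (hvℓ : ∀ i, Submodule.span ℂ {v i} = ℓ i) (hspan : ⨆ i, ℓ i = ⊤)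
    (hne : ∀ i j, inner ℂ (v i) (v j) ≠ (0 : ℂ)) {Q Q' : V ≃ₗᵢ[ℂ] V} {σ : Fin n → Fin n}
    (hQ : ∀ i, (ℓ i).map (Q.toLinearEquiv : V →ₗ[ℂ] V) = ℓ (σ i))
    (hQ' : ∀ i, (ℓ i).map (Q'.toLinearEquiv : V →ₗ[ℂ] V) = ℓ (σ i)) :
    ∃ c : Circle, ∀ u, Q u = c • Q' u := by
  choose z hz using exists_phase_of_map hv hvℓ hQ
  choose w hw using exists_phase_of_map hv hvℓ hQ'
  -- Both unitaries preserve the inner product of `v i` and `v j`; cancelling the nonzero inner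
  -- product of the image vectors shows that the phase ratios agree, so `z i / w i` does not depend
  -- on `i`.
  have hzw : ∀ i j, (z i)⁻¹ * z j = (w i)⁻¹ * w j := by
    intro i j
    have h : (inner ℂ (Q (v i)) (Q (v j)) : ℂ) = inner ℂ (Q' (v i)) (Q' (v j)) := by
      rw [Q.inner_map_map, Q'.inner_map_map]
    simp only [hz, hw, circle_smul_eq_coe_smul, inner_smul_left, inner_smul_right] at h
    rw [← mul_assoc, ← mul_assoc] at h
    apply Circle.ext
    rw [Circle.coe_mul, Circle.coe_mul, Circle.coe_inv_eq_conj, Circle.coe_inv_eq_conj,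
      mul_comm, mul_comm _ (w j : ℂ)]
    exact mul_right_cancel₀ (hne (σ i) (σ j)) h
  refine ⟨z 0 * (w 0)⁻¹, ?_⟩
  have hv' : ∀ i, Q (v i) = (z 0 * (w 0)⁻¹) • Q' (v i) := by
    intro i
    rw [hz, hw, smul_smul, mul_assoc, ← hzw 0 i, mul_inv_cancel_left]
  have hle : (⊤ : Submodule ℂ V) ≤ LinearMap.eqLocus (Q.toLinearEquiv : V →ₗ[ℂ] V)
      (((z 0 * (w 0)⁻¹ : Circle) : ℂ) • (Q'.toLinearEquiv : V →ₗ[ℂ] V)) := by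
    rw [← hspan]
    refine iSup_le fun i => ?_
    rw [← hvℓ, Submodule.span_singleton_le_iff_mem]
    exact hv' i
  exact fun u => hle Submodule.mem_top

theorem inner_ne_zero_of_finrank_lt [FiniteDimensional ℂ V] (hd : Module.finrank ℂ V < n)
    (hv : ∀ i, ‖v i‖ = 1) (hvℓ : ∀ i, Submodule.span ℂ {v i} = ℓ i)
    (hAut : ∀ {a b c d : Fin n}, a ≠ b → c ≠ d → ∃ (Q : V ≃ₗᵢ[ℂ] V) (σ : Fin n → Fin n),
      (∀ i, (ℓ i).map (Q.toLinearEquiv : V →ₗ[ℂ] V) = ℓ (σ i)) ∧ σ a = c ∧ σ b = d)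
    (i j : Fin n) : inner ℂ (v i) (v j) ≠ (0 : ℂ) := by
  intro h0
  have hself : ∀ k, inner ℂ (v k) (v k) = (1 : ℂ) := fun k => by
    rw [inner_self_eq_norm_sq_to_K, hv]; simp
  have hij : i ≠ j := by
    rintro rfl
    exact one_ne_zero ((hself i).symm.trans h0)
  have hli := EquivariantLines.linearIndependent_of_inner (v := v) (T := LinearMap.id)
    one_ne_zero hself (fun a b hab => by
      obtain ⟨Q, σ, hQ, rfl, rfl⟩ := hAut hij hab
      rw [LinearMap.id_apply, ← norm_eq_zero, norm_inner_of_map hv hvℓ hQ, h0, norm_zero])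
  have := hli.fintype_card_le_finrank
  rw [Fintype.card_fin] at this
  exact absurd hd (not_lt.mpr this)

/-- If one pair attains equality in Cauchy–Schwarz, double transitivity makes every line equal to `ℓ
i`, and the span has dimension at most 1. -/
theorem norm_inner_ne_one_of_two_le_finrank (hd : 2 ≤ Module.finrank ℂ V)
    (hv : ∀ i, ‖v i‖ = 1) (hvℓ : ∀ i, Submodule.span ℂ {v i} = ℓ i) (hspan : ⨆ i, ℓ i = ⊤)
    (hAut : ∀ {a b c d : Fin n}, a ≠ b → c ≠ d → ∃ (Q : V ≃ₗᵢ[ℂ] V) (σ : Fin n → Fin n),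
      (∀ i, (ℓ i).map (Q.toLinearEquiv : V →ₗ[ℂ] V) = ℓ (σ i)) ∧ σ a = c ∧ σ b = d)
    {i j : Fin n} (hij : i ≠ j) : ‖(inner ℂ (v i) (v j) : ℂ)‖ ≠ 1 := by
  intro h1
  have hall : ∀ k, ℓ k ≤ Submodule.span ℂ {v i} := by
    intro k
    rw [← hvℓ, Submodule.span_singleton_le_iff_mem]
    by_cases hk : i = k
    · rw [hk]
      exact Submodule.mem_span_singleton_self _
    · obtain ⟨Q, σ, hQ, hi, hk'⟩ := hAut hij hk
      have h2 := norm_inner_of_map hv hvℓ hQ i j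
      rw [hi, hk', h1] at h2
      have hvi : ∀ m, v m ≠ 0 := fun m => norm_ne_zero_iff.mp (by rw [hv]; exact one_ne_zero)
      obtain ⟨c, -, hc⟩ := (norm_inner_eq_norm_iff (𝕜 := ℂ) (hvi i) (hvi k)).mp
        (by rw [h2, hv, hv, one_mul])
      exact Submodule.mem_span_singleton.mpr ⟨c, hc.symm⟩
  have htop : Submodule.span ℂ {v i} = ⊤ := top_le_iff.mp (hspan ▸ iSup_le hall)
  have hle := finrank_span_le_card (R := ℂ) ({v i} : Set V)
  rw [htop, finrank_top] at hle
  simp at hle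
  omega

end Lines

/-! ### The radicalization of a character -/

section Radical

variable {Gs : Type*} [Group Gs] {S : Subgroup Gs}

theorem mem_radSubgroup_iff (α : S →* Circle) (g : Gs × radRoots α) :
    g ∈ radSubgroup α ↔ ∃ hx : g.1 ∈ S, Circle.toUnits (α ⟨g.1, hx⟩) * (g.2 : ℂˣ) = 1 := by
  constructor
  · rintro ⟨⟨x, z⟩, hx, rfl⟩
    exact ⟨x.2, congrArg Subtype.val (MonoidHom.mem_ker.mp hx)⟩
  · rintro ⟨hx, h⟩
    exact ⟨(⟨g.1, hx⟩, g.2), MonoidHom.mem_ker.mpr (Subtype.ext h), rfl⟩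

theorem radOrder_ne_zero [Finite Gs] (α : S →* Circle) : radOrder α ≠ 0 := by
  have : Finite α.range := Set.finite_range α
  exact mul_ne_zero two_ne_zero Nat.card_pos.ne'

/-- Values of `α` are squares in the group of roots of unity of the radicalization. -/
theorem exists_mul_sq_eq_one [Finite Gs] (α : S →* Circle) (x : S) :
    ∃ z : radRoots α, Circle.toUnits (α x) * ((z : ℂˣ) * (z : ℂˣ)) = 1 := by
  -- A square root of an inverse value of `α` has order dividing twice the order of the image, that
  -- is, dividing `radOrder α`.
  obtain ⟨s, hs⟩ := exists_units_pow_eq two_ne_zero (Circle.toUnits (α x))⁻¹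
  have h : (⟨α x, x, rfl⟩ : α.range) ^ Nat.card α.range = 1 := pow_card_eq_one'
  have h' : α x ^ Nat.card α.range = 1 := congrArg Subtype.val h
  refine ⟨⟨s, ?_⟩, ?_⟩
  · rw [mem_rootsOfUnity, radOrder, pow_mul, hs, inv_pow, ← map_pow, h', map_one, inv_one]
  · change _ * (s * s) = 1
    rw [← pow_two, hs, mul_inv_cancel]

end Radical

/-! ### Construction of the representation and the main theorem -/

theorem exists_equivariantLines {n d : ℕ} (hn : 3 ≤ n) (hd : d < n)
    (G : Subgroup (Equiv.Perm (Fin n)))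
    (hG : MulAction.IsMultiplyPretransitive G (Fin n) 2)
    (ℓ : Fin n → Submodule ℂ (EuclideanSpace ℂ (Fin d)))
    (hline : ∀ i, Module.finrank ℂ (ℓ i) = 1)
    (hspan : ⨆ i, ℓ i = ⊤)
    (hAut : ∀ σ ∈ G, IsLineAutomorphism ℓ σ)
    {Gs : Type*} [Group Gs] (π : Gs →* G) (hπ : IsSchurCovering π) (i₀ : Fin n) :
    ∃ (α : (MulAction.stabilizer G i₀).comap π →* Circle)
      (L : EquivariantLines (radSubgroup α) (EuclideanSpace ℂ (Fin d)) n (radOrder α)),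
      (∀ g, Submodule.span ℂ {L.rep g L.vec} = ℓ (L.perm g L.base)) ∧
      (2 ≤ d → ∀ g, L.perm g L.base ≠ L.base → ‖L.coeff g‖ ≠ 1) := by
  have : NeZero n := ⟨by omega⟩
  have hfin : Finite Gs := hπ.finite
  have hrank : Module.finrank ℂ (EuclideanSpace ℂ (Fin d)) = d := finrank_euclideanSpace_fin
  rw [MulAction.is_two_pretransitive_iff] at hG
  choose v hv hvℓ using fun i => exists_unit_span (hline i)
  have : Nontrivial (EuclideanSpace ℂ (Fin d)) :=
    ⟨v i₀, 0, norm_ne_zero_iff.mp (by rw [hv]; exact one_ne_zero)⟩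
  choose q hq using fun σ : G => hAut σ.1 σ.2
  have hAut' : ∀ {a b c e : Fin n}, a ≠ b → c ≠ e →
      ∃ (Q : EuclideanSpace ℂ (Fin d) ≃ₗᵢ[ℂ] EuclideanSpace ℂ (Fin d)) (σ : Fin n → Fin n),
      (∀ i, (ℓ i).map (Q.toLinearEquiv : EuclideanSpace ℂ (Fin d) →ₗ[ℂ] EuclideanSpace ℂ (Fin d))
        = ℓ (σ i)) ∧ σ a = c ∧ σ b = e := by
    intro a b c e hab hce
    obtain ⟨σ, h1, h2⟩ := hG hab hce
    exact ⟨q σ, σ.1, hq σ, h1, h2⟩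
  have hne := inner_ne_zero_of_finrank_lt (hrank.trans_lt hd) hv hvℓ hAut'
  have hcoc : ∀ σ τ : G, ∃ c : Circle, ∀ u, q σ (q τ u) = c • q (σ * τ) u := by
    intro σ τ
    refine exists_phase_of_map_eq (Q := (q τ).trans (q σ)) (σ := (σ * τ).1) hv hvℓ hspan hne ?_
      (hq (σ * τ))
    intro i
    rw [Subgroup.coe_mul, Equiv.Perm.mul_apply, ← hq σ, ← hq τ, ← Submodule.map_comp]
    rfl
  choose f hf using hcoc
  obtain ⟨ρ, c, hρ⟩ := hπ.exists_lift q f hf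
  have hρv : ∀ x i, ∃ z : Circle, ρ x (v i) = z • v ((π x).1 i) := by
    intro x i
    obtain ⟨z, hz⟩ := exists_phase_of_map hv hvℓ (hq (π x)) i
    exact ⟨c x * z, by rw [hρ, hz, smul_smul]⟩
  have hρinner : ∀ x u w, inner ℂ (ρ x u) (ρ x w) = (inner ℂ u w : ℂ) := by
    intro x u w
    rw [hρ, hρ, circle_smul_eq_coe_smul, circle_smul_eq_coe_smul, inner_smul_left,
      inner_smul_right, LinearIsometryEquiv.inner_map_map, ← mul_assoc, ← Circle.coe_inv_eq_conj,
      ← Circle.coe_mul, inv_mul_cancel, Circle.coe_one, one_mul]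
  have hstab : ∀ x : (MulAction.stabilizer G i₀).comap π, (π x).1 i₀ = i₀ := fun x => x.2
  have hαex : ∀ x : (MulAction.stabilizer G i₀).comap π, ∃ z : Circle,
      ρ x (v i₀) = z • v i₀ := by
    intro x
    obtain ⟨z, hz⟩ := hρv x i₀
    exact ⟨z, by rw [hz, hstab]⟩
  choose a ha using hαex
  let α : (MulAction.stabilizer G i₀).comap π →* Circle := MonoidHom.mk' a (by
    intro x y
    apply circle_smul_right_injective (hv i₀)
    rw [← ha, Subgroup.coe_mul, map_mul, Module.End.mul_apply, ha, circle_smul_eq_coe_smul,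
      map_smul, ha, mul_comm, mul_smul]
    rfl)
  have hα : ∀ x : (MulAction.stabilizer G i₀).comap π, ρ x (v i₀) = ((Circle.toUnits (α x) : ℂˣ) : ℂ) • v i₀ := ha
  let perm : Gs × radRoots α →* Equiv.Perm (Fin n) :=
    (G.subtype.comp π).comp (MonoidHom.fst Gs (radRoots α))
  let rep : Gs × radRoots α →* Module.End ℂ (EuclideanSpace ℂ (Fin d)) :=
    { toFun := fun g => ((g.2 : ℂˣ) : ℂ) • ρ g.1
      map_one' := by simp
      map_mul' := fun g g' => by
        simp only [Prod.fst_mul, Prod.snd_mul, map_mul, Subgroup.coe_mul, Units.val_mul,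
          smul_mul_smul_comm] }
  have hrep : ∀ g u, rep g u = ((g.2 : ℂˣ) : ℂ) • ρ g.1 u := fun g u => rfl
  have : NeZero (radOrder α) := ⟨radOrder_ne_zero α⟩
  have hroot : ∀ z : radRoots α, ‖((z : ℂˣ) : ℂ)‖ = 1 := fun z =>
    Complex.norm_eq_one_of_mem_rootsOfUnity z.2
  have hrepv : ∀ g, ∃ z : Circle, rep g (v i₀) = z • v (perm g i₀) := by
    intro g
    obtain ⟨z, hz⟩ := hρv g.1 i₀
    obtain ⟨w, hw⟩ : ∃ w : Circle, (w : ℂ) = ((g.2 : ℂˣ) : ℂ) :=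
      ⟨⟨_, mem_sphere_zero_iff_norm.mpr (hroot g.2)⟩, rfl⟩
    refine ⟨w * z, ?_⟩
    rw [hrep, hz, mul_smul, circle_smul_eq_coe_smul w, hw]
    rfl
  have hspanrep : ∀ g, Submodule.span ℂ {rep g (v i₀)} = ℓ (perm g i₀) := by
    intro g
    obtain ⟨z, hz⟩ := hrepv g
    rw [hz, circle_smul_eq_coe_smul, Submodule.span_singleton_smul_eq z.coe_ne_zero.isUnit, hvℓ]
  have hpermex : ∀ {a b c e : Fin n}, a ≠ b → c ≠ e → ∃ g, perm g a = c ∧ perm g b = e := by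
    intro a b c e hab hce
    obtain ⟨σ, h1, h2⟩ := hG hab hce
    obtain ⟨x, rfl⟩ := hπ.surjective σ
    exact ⟨(x, 1), h1, h2⟩
  have : Nontrivial (Fin n) := Fin.nontrivial_iff_two_le.mpr (by omega)
  have hα' : ∀ (g : Gs × radRoots α) (hg : g.1 ∈ (MulAction.stabilizer G i₀).comap π),
      rep g (v i₀) = ((Circle.toUnits (α ⟨g.1, hg⟩) * (g.2 : ℂˣ) : ℂˣ) : ℂ) • v i₀ := by
    intro g hg
    rw [hrep, hα ⟨g.1, hg⟩, smul_smul, Units.val_mul, mul_comm]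
  let L : EquivariantLines (radSubgroup α) (EuclideanSpace ℂ (Fin d)) n (radOrder α) :=
    { perm := perm
      rep := rep
      base := i₀
      vec := v i₀
      scalar := MonoidHom.inr Gs (radRoots α)
      inner_rep := by
        intro g u w
        rw [hrep, hrep, inner_smul_left, inner_smul_right, hρinner, ← mul_assoc,
          ← Complex.normSq_eq_conj_mul_self, Complex.normSq_eq_norm_sq, hroot]
        simp
      norm_vec := hv i₀
      mem_iff := by
        intro g
        rw [mem_radSubgroup_iff]
        constructor
        · rintro ⟨hx, h⟩
          refine ⟨hx, ?_⟩
          rw [hα' g hx, h, Units.val_one, one_smul]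
        · rintro ⟨hx, h⟩
          refine ⟨hx, ?_⟩
          rw [hα' g hx] at h
          exact Units.ext (smul_left_injective ℂ
            (norm_ne_zero_iff.mp (by rw [hv]; exact one_ne_zero)) (h.trans (one_smul ℂ _).symm))
      exists_perm := hpermex
      rep_scalar := by
        intro z u
        rw [hrep, MonoidHom.inr_apply, map_one, Module.End.one_apply]
      scalar_comm := by
        intro z g
        apply Prod.ext
        · simp
        · exact mul_comm _ _
      perm_scalar := by
        intro z
        simp [perm]
      exists_phase := by
        intro g hg
        -- The phase on the base line is the value of the extended character, whose kernel gives
        -- `H`.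
        exact ⟨radCharacter α (⟨g.1, hg⟩, g.2), hα' g hg⟩
      inner_ne_zero := by
        intro g
        obtain ⟨z, hz⟩ := hrepv g
        rw [hz, circle_smul_eq_coe_smul, inner_smul_right]
        exact mul_ne_zero z.coe_ne_zero (hne _ _)
      span_orbit := by
        rw [eq_top_iff, ← hspan]
        refine iSup_le fun i => ?_
        obtain ⟨g, hg⟩ : ∃ g, perm g i₀ = i := by
          obtain ⟨j, hj⟩ := exists_ne i₀
          obtain ⟨m, hm⟩ := exists_ne i
          obtain ⟨g, hg, -⟩ := hpermex hj.symm hm.symm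
          exact ⟨g, hg⟩
        rw [← hg, ← hspanrep]
        exact Submodule.span_mono (Set.singleton_subset_iff.mpr ⟨g, rfl⟩)
      three_le := hn
      finrank_lt := hrank.trans_lt hd
      exists_swap := by
        obtain ⟨j, hj⟩ := exists_ne i₀
        -- Some `σ` swaps `i₀` and `j`, so the square of a lift `x` fixes `i₀`; the scalar `z` with
        -- `z² = α(x²)⁻¹` then puts the square of `(x, z)` in `H`.
        obtain ⟨σ, h1, h2⟩ := hG hj.symm hj
        obtain ⟨x, rfl⟩ := hπ.surjective σ
        have hxx : x * x ∈ (MulAction.stabilizer G i₀).comap π := by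
          rw [Subgroup.mem_comap, map_mul, MulAction.mem_stabilizer_iff, mul_smul, h1, h2]
        obtain ⟨z, hz⟩ := exists_mul_sq_eq_one α ⟨x * x, hxx⟩
        refine ⟨(x, z), fun h => hj (h1.symm.trans h), ?_⟩
        exact (mem_radSubgroup_iff α _).mpr ⟨hxx, hz⟩ }
  refine ⟨α, L, hspanrep, fun hd2 g hg => ?_⟩
  obtain ⟨z, hz⟩ := hrepv g
  change ‖(inner ℂ (v i₀) (rep g (v i₀)) : ℂ)‖ ≠ 1
  rw [hz, circle_smul_eq_coe_smul, inner_smul_right, norm_mul, Circle.norm_coe, one_mul]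
  exact norm_inner_ne_one_of_two_le_finrank (hd2.trans_eq hrank.symm) hv hvℓ hspan hAut'
    (Ne.symm hg)

theorem mainTheorem2 {n d : ℕ} (hn : 3 ≤ n) (hd : d < n)
    (G : Subgroup (Equiv.Perm (Fin n)))
    (hG : MulAction.IsMultiplyPretransitive G (Fin n) 2)
    (ℓ : Fin n → Submodule ℂ (EuclideanSpace ℂ (Fin d)))
    (hline : ∀ i, Module.finrank ℂ (ℓ i) = 1)
    (hspan : ⨆ i, ℓ i = ⊤)
    (hAut : ∀ σ ∈ G, IsLineAutomorphism ℓ σ)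
    {Gs : Type*} [Group Gs] (π : Gs →* G) (hπ : IsSchurCovering π) (i₀ : Fin n) :
    ∃ α : (MulAction.stabilizer G i₀).comap π →* Circle,
      IsHigmanPair (radSubgroup α) ∧
      (Subgroup.normalizer (radSubgroup α : Set (Gs × radRoots α))).index = n ∧
      (radSubgroup α).relIndex
        (Subgroup.normalizer (radSubgroup α : Set (Gs × radRoots α))) = radOrder α ∧
      ∃ (_ : Fintype ((Gs × radRoots α) ⧸ radSubgroup α))
        (E : Matrix ((Gs × radRoots α) ⧸ radSubgroup α) ((Gs × radRoots α) ⧸ radSubgroup α) ℂ),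
        IsPrimitiveIdempotent (schurianScheme (radSubgroup α)) E ∧
        IsGramOfRepresentatives ℓ (radOrder α) E ∧
        (2 ≤ d → CarriesScheme (schurianScheme (radSubgroup α)) E) := by
  obtain ⟨α, L, hℓ, hnorm⟩ :=
    exists_equivariantLines hn hd G hG ℓ hline hspan hAut π hπ i₀
  have hfin : Finite Gs := hπ.finite
  have : NeZero (radOrder α) := ⟨radOrder_ne_zero α⟩
  let _ : Fintype ((Gs × radRoots α) ⧸ radSubgroup α) := Fintype.ofFinite _
  obtain ⟨a, ha, hg⟩ := L.exists_gram_mul_gram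
  refine ⟨α, L.isHigmanPair, L.index_normalizer, L.relIndex_normalizer, inferInstance,
    ((a⁻¹ : ℝ) : ℂ) • L.gram, L.isPrimitiveIdempotent ha hg,
    L.isGramOfRepresentatives hℓ (inv_pos.mpr ha), fun hd2 => ?_⟩
  exact L.carriesScheme (Complex.ofReal_ne_zero.mpr (inv_ne_zero ha.ne')) (hnorm hd2)
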